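/- Fix an integer $T\ge 2$, write $\mathcal T=\{1,\dots,T\}$, and let $i\in\mathcal T$ with $i\ge 2$. Consider the special model. For each $j\in\mathcal T$, $(D_{j,k},Z_{j,k})_{k\ge1}$ is an i.i.d. sequence of pairs of random variables with values in $\mathcal T\times\mathbb R$, whose common law (that of a generic pair $(D,Z)$) does not depend on $j$; $\operatorname{E}[Z^2]<\infty$, $\operatorname{E}[Z I\{D=t\}]>0$ for every $t\in\mathcal T$, and $D$ and $Z$ are independent. For each $j\in\mathcal T$, $(M^\alpha_j)_{\alpha\ge0}$ is a homogeneous Poisson process with intensity $\lambda_j\in(0,\infty)$. For every $\alpha$, the count $M^\alpha_j$ is independent of $(D_{j,k},Z_{j,k})_{k\ge1}$ for each $j$, and the families $\{M^\alpha_j,(D_{j,k},Z_{j,k})_{k\ge1}\}$, $j=1,\dots,T$, are independent. Put $$C^\alpha_{j,t}=\sum_{k=1}^{M^\alpha_j}Z_{j,k}I\{D_{j,k}\le t\},\qquad f_t=\frac{\operatorname{E}[ZI\{D\le t+1\}]}{\operatorname{E}[ZI\{D\le t\}]},$$ $$\sigma_t^2=(f_t-1)\Big(\frac{\operatorname{E}[Z^2I\{D=t+1\}]}{\operatorname{E}[ZI\{D=t+1\}]}+(f_t-1)\frac{\operatorname{E}[Z^2I\{D\le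 t\}]}{\operatorname{E}[ZI\{D\le t\}]}\Big),$$ let $\mathcal D^\alpha$ be the $\sigma$-algebra generated by $\{C^\alpha_{j,t}: j,t\in\mathcal T,\ j+t\le T+1\}$, and write $g=\prod_{s=T-i+1}^{T-1}f_s$ and $$(H^\alpha)^2=\frac{(C^\alpha_{i,T-i+1}-\operatorname{E}[C^\alpha_{i,T-i+1}])^2}{\alpha}.$$ Quotients with denominator $C^\alpha_{i,T-i+1}$ are read as $0$ on the event $\{C^\alpha_{i,T-i+1}=0\}$. Conditional expectations are taken in the extended sense: $Y$ is a version of $\operatorname{E}[X\mid\mathcal D]$ if $Y$ is $\mathcal D$-measurable and the sample space is a countable union of sets $A_n\in\mathcal D$ on each of which $X$ and $Y$ are integrable, with $\operatorname{E}[X I_B]=\operatorname{E}[Y I_B]$ for all $B\in\mathcal D$, $B\subseteq A_n$. ($X$ itself need not be integrable; for integrable $X$ this is the ordinary notion.) Let $\chi^2_1$ denote a random variable with the chi squared distribution with one degree of freedom. Then the following hold. (1) For every $\alpha>0$, almost surely, $$\operatorname{E}\Big[\frac{(C^\alpha_{i,T}-C^\alpha_{i,T-i+1}\,g)^2}{C^\alpha_{i,T-i+1}}\,\Big|\,\mathcal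 D^\alpha\Big]=\frac{\alpha}{C^\alpha_{i,T-i+1}}\Big(\frac{\operatorname{E}[M^\alpha_i]}{\alpha}\operatorname{E}[Z^2]\operatorname{P}(D>T-i+1)+(H^\alpha)^2(g-1)^2\Big).$$ (2) As $\alpha\to\infty$, this conditional expectation converges in distribution to $$\frac{\operatorname{E}[Z^2]}{\operatorname{E}[Z]}\big((g-1)+(g-1)^2\chi^2_1\big),$$ and $(H^\alpha)^2$ converges in distribution to $H^2:=\lambda_i\operatorname{E}[Z^2]\operatorname{P}(D\le T-i+1)\,\chi^2_1$. (3) The limit variable in (2) and $H^2$ are integrable, and the expectation of the limit variable is $$\frac{\lambda_i\operatorname{E}[Z^2]\operatorname{P}(D>T-i+1)+\operatorname{E}[H^2](g-1)^2}{\lambda_i\operatorname{E}[Z]\operatorname{P}(D\le T-i+1)}=\sum_{t=T-i+1}^{T-1}f_{T-i+1}\cdots f_{t-1}\,\sigma_t^2\,f_{t+1}^2\cdots f_{T-1}^2.$$ -/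

import Mathlib

open MeasureTheory ProbabilityTheory Filter Topology
open scoped NNReal ENNReal

namespace ChainLadder

/-- `Y` is a version of the conditional expectation `E[X | m]`, in the usual extended sense for
variables that are `σ`-integrable given `m`: `Y` is `m`-measurable and the space is covered by
countably many `m`-measurable sets on each of which `X` and `Y` are integrable and have the same
integral over all `m`-measurable subsets.  If `X` is integrable, one may take the whole space as the
only set, and this is the ordinary notion; in general `X` need not be integrable. -/
structure IsCondExp {Ω : Type*} (m : MeasurableSpace Ω) [MeasurableSpace Ω] (μ : Measure Ω)
    (X Y : Ω → ℝ) : Prop where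
  measurable : Measurable[m] Y
  exists_cover : ∃ A : ℕ → Set Ω, (∀ n, MeasurableSet[m] (A n)) ∧ (⋃ n, A n) = Set.univ ∧
    ∀ n, IntegrableOn X (A n) μ ∧ IntegrableOn Y (A n) μ ∧
      ∀ B, MeasurableSet[m] B → B ⊆ A n → ∫ ω in B, Y ω ∂μ = ∫ ω in B, X ω ∂μ

/-- A homogeneous Poisson process `(N_a)_{a ≥ 0}` with intensity `r`: an (almost surely)
nondecreasing right-continuous counting process started at `0`, with independent increments, the
increment over `(a, b]` being Poisson distributed with mean `r (b - a)`. -/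
structure IsPoissonProcess {Ω : Type*} [MeasurableSpace Ω] (N : ℝ≥0 → Ω → ℕ) (r : ℝ≥0)
    (P : Measure Ω) : Prop where
  measurable : ∀ a, Measurable (N a)
  zero : ∀ᵐ ω ∂P, N 0 ω = 0
  monotone : ∀ᵐ ω ∂P, Monotone fun a => N a ω
  rightContinuous : ∀ᵐ ω ∂P, ∀ a, ContinuousWithinAt (fun b => N b ω) (Set.Ici a) a
  indepIncrements : HasIndepIncrements (fun a ω => (N a ω : ℤ)) P
  law_increment : ∀ a b, a ≤ b →
    HasLaw (fun ω => N b ω - N a ω) (poissonMeasure (r * (b - a))) P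

/-- The chi squared distribution with one degree of freedom. -/
noncomputable def chiSquaredOne : Measure ℝ := (gaussianReal 0 1).map fun x => x ^ 2

/-- The special model with `T` accident years and `T` development years, both numbered `1, …, T`
(values of the families below at other years are irrelevant).  `M i a` is the number of accident
events of year `i` at exposure `a`; `Z i k` and `D i k` are the size and the development year of the
claim number `k` of accident year `i`, and `(D₀, Z₀)` is the generic pair.  The claims of
one accident year are numbered `k = 0, 1, 2, …`. -/
structure SpecialModel {Ω : Type*} [MeasurableSpace Ω] (P : Measure Ω) (T : ℕ) (lam : ℕ → ℝ≥0)
    (M : ℕ → ℝ≥0 → Ω → ℕ) (D : ℕ → ℕ → Ω → ℕ) (Z : ℕ → ℕ → Ω → ℝ)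
    (D₀ : Ω → ℕ) (Z₀ : Ω → ℝ) : Prop where
  measurable_D : ∀ i ∈ Finset.Icc 1 T, ∀ k, Measurable (D i k)
  measurable_Z : ∀ i ∈ Finset.Icc 1 T, ∀ k, Measurable (Z i k)
  measurable_D₀ : Measurable D₀
  measurable_Z₀ : Measurable Z₀
  /-- development years lie in `{1, …, T}` -/
  mem_years : ∀ᵐ ω ∂P, D₀ ω ∈ Finset.Icc 1 T
  /-- for each accident year the pairs `(D i k, Z i k)` are independent in `k` … -/
  indep_claims : ∀ i ∈ Finset.Icc 1 T, iIndepFun (fun k ω => (D i k ω, Z i k ω)) P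
  /-- … with a common law that does not depend on the accident year -/
  identDistrib : ∀ i ∈ Finset.Icc 1 T, ∀ k,
    IdentDistrib (fun ω => (D i k ω, Z i k ω)) (fun ω => (D₀ ω, Z₀ ω)) P P
  sq_integrable : MemLp Z₀ 2 P
  mean_pos : ∀ t ∈ Finset.Icc 1 T, 0 < ∫ ω, (if D₀ ω = t then Z₀ ω else 0) ∂P
  /-- claims and claim counts of one accident year are independent -/
  indep_count : ∀ i ∈ Finset.Icc 1 T, ∀ a,
    IndepFun (fun ω k => (D i k ω, Z i k ω)) (M i a) P
  /-- different accident years are independent -/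
  indep_years : ∀ a, iIndepFun
    (fun (i : Finset.Icc 1 T) ω => (M i a ω, fun k => (D i k ω, Z i k ω))) P
  /-- development year and claim size are independent -/
  indep_D_Z : IndepFun D₀ Z₀ P
  /-- claim counts are homogeneous Poisson processes, as functions of the exposure -/
  lam_pos : ∀ i ∈ Finset.Icc 1 T, 0 < lam i
  poisson : ∀ i ∈ Finset.Icc 1 T, IsPoissonProcess (M i) (lam i) P

section Notions

variable {Ω : Type*}

/-- `C^a_{i,t}`: the accumulated claims amount of accident year `i` up to and including development
year `t`, at exposure `a`. -/
noncomputable def cumClaims (M : ℕ → ℝ≥0 → Ω → ℕ) (D : ℕ → ℕ → Ω → ℕ) (Z : ℕ → ℕ → Ω → ℝ)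
    (i t : ℕ) (a : ℝ≥0) (ω : Ω) : ℝ :=
  ∑ k ∈ Finset.range (M i a ω), if D i k ω ≤ t then Z i k ω else 0

/-- The `σ`-algebra generated by the observed run-off triangle
`C^a_{j,t}`, `j, t ∈ {1, …, T}`, `j + t ≤ T + 1`. -/
@[reducible]
noncomputable def observed (T : ℕ) (M : ℕ → ℝ≥0 → Ω → ℕ) (D : ℕ → ℕ → Ω → ℕ) (Z : ℕ → ℕ → Ω → ℝ)
    (a : ℝ≥0) : MeasurableSpace Ω :=
  ⨆ (j ∈ Finset.Icc 1 T) (t ∈ Finset.Icc 1 T) (_ : j + t ≤ T + 1),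
    MeasurableSpace.comap (cumClaims M D Z j t a) inferInstance

variable [MeasurableSpace Ω]

/-- The development factor `f_t = E[Z I{D ≤ t+1}] / E[Z I{D ≤ t}]`. -/
noncomputable def devFactor (P : Measure Ω) (D₀ : Ω → ℕ) (Z₀ : Ω → ℝ) (t : ℕ) : ℝ :=
  (∫ ω, (if D₀ ω ≤ t + 1 then Z₀ ω else 0) ∂P) / ∫ ω, (if D₀ ω ≤ t then Z₀ ω else 0) ∂P

/-- `σ²_t = (f_t - 1) (E[Z² I{D = t+1}] / E[Z I{D = t+1}]
  + (f_t - 1) E[Z² I{D ≤ t}] / E[Z I{D ≤ t}])`. -/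
noncomputable def sigmaSq (P : Measure Ω) (D₀ : Ω → ℕ) (Z₀ : Ω → ℝ) (t : ℕ) : ℝ :=
  (devFactor P D₀ Z₀ t - 1) *
    ((∫ ω, (if D₀ ω = t + 1 then Z₀ ω ^ 2 else 0) ∂P) /
        (∫ ω, (if D₀ ω = t + 1 then Z₀ ω else 0) ∂P)
      + (devFactor P D₀ Z₀ t - 1) *
        ((∫ ω, (if D₀ ω ≤ t then Z₀ ω ^ 2 else 0) ∂P) /
          ∫ ω, (if D₀ ω ≤ t then Z₀ ω else 0) ∂P))

/-- The product `f_{T-i+1} ⋯ f_{T-1}`. -/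
noncomputable def devProduct (P : Measure Ω) (T : ℕ) (D₀ : Ω → ℕ) (Z₀ : Ω → ℝ) (i : ℕ) : ℝ :=
  ∏ s ∈ Finset.Ico (T - i + 1) T, devFactor P D₀ Z₀ s

/-- The standardized squared error
`(C^a_{i,T} - C^a_{i,T-i+1} f_{T-i+1} ⋯ f_{T-1})² / C^a_{i,T-i+1}`. -/
noncomputable def standardizedSqError (P : Measure Ω) (T : ℕ) (M : ℕ → ℝ≥0 → Ω → ℕ)
    (D : ℕ → ℕ → Ω → ℕ) (Z : ℕ → ℕ → Ω → ℝ) (D₀ : Ω → ℕ) (Z₀ : Ω → ℝ)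
    (i : ℕ) (a : ℝ≥0) (ω : Ω) : ℝ :=
  (cumClaims M D Z i T a ω - cumClaims M D Z i (T - i + 1) a ω * devProduct P T D₀ Z₀ i) ^ 2 /
    cumClaims M D Z i (T - i + 1) a ω

/-- `(H^a)² = (C^a_{i,T-i+1} - E[C^a_{i,T-i+1}])² / a`. -/
noncomputable def HSq (P : Measure Ω) (T : ℕ) (M : ℕ → ℝ≥0 → Ω → ℕ)
    (D : ℕ → ℕ → Ω → ℕ) (Z : ℕ → ℕ → Ω → ℝ) (i : ℕ) (a : ℝ≥0) (ω : Ω) : ℝ :=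
  (cumClaims M D Z i (T - i + 1) a ω - ∫ ω', cumClaims M D Z i (T - i + 1) a ω' ∂P) ^ 2 / (a : ℝ)

end Notions

end ChainLadder

/-!
Within accident year `i` the claims form a Poisson sample: a Poisson number of i.i.d. marks. The
outstanding amount `X = C_{i,T} - C_{i,T-i+1}` and the observed amounts `C_{i,s}`, `s ≤ T-i+1`, are
random sums over marks with disjoint supports, so that they are independent by Poisson thinning
(`IsPoissonSample.indepFun_sum_sum`, read off from the characteristic function of compound Poisson
laws). As accident years are independent, `X` is independent of the whole observed triangle
(`SpecialModel.indep_observed`). The standardized squared error is `(X - (g - 1) C)² / C` with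
`C = C_{i,T-i+1}` measurable for the triangle; expanding the square and factoring expectations over
sets on which `C` and `1 / C` are bounded gives the conditional expectation
`(Var X + (E X - (g - 1) C)²) / C` (`isCondExp_sq_sub_div`). Since `g = 1 / P(D ≤ T-i+1)` by
independence of `D` and `Z` and telescoping, `E X = (g - 1) E C`, and the second square is
`(g - 1)² (C - E C)²`.

For the limits, the second order expansion of characteristic functions and Lévy's theorem give a
central limit theorem for compound Poisson sums (`tendstoInDistribution_poissonSum`), whence
`(H^a)²` converges to a multiple of a squared Gaussian; Chebyshev's inequality shows that `C / a`
concentrates at the constant `E C / a`, and Slutsky's theorem combines the two. Versions of the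
conditional expectation agree almost surely (`IsCondExp.ae_eq`), so every version has that limit.

Finally `σ²_t = (E[Z²] / E[Z]) f_t (f_t - 1)`, and with `f_t = q_{t+1} / q_t`, `q_t = P(D ≤ t)`, the
sum over development years telescopes to `(E[Z²] / E[Z]) g (g - 1)` (`sum_prod_mul_prod_sq`), which
is the mean of the limit since a chi squared variable has mean one.
-/

namespace ChainLadder

/-! ### Moments of the Poisson distribution -/

lemma hasSum_poisson_mul (r : ℝ≥0) :
    HasSum (fun n : ℕ => Real.exp (-r) * (r : ℝ) ^ n / n.factorial * n) r := by
  rw [← hasSum_nat_add_iff' 1]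
  have h := (hasSum_one_poissonMeasure r).mul_left (r : ℝ)
  simp only [Finset.range_one, Finset.sum_singleton, Nat.cast_zero, mul_zero, sub_zero]
  rw [mul_one] at h
  refine (congrArg (fun f : ℕ → ℝ => HasSum f (r : ℝ)) (funext fun n => ?_)).mpr h
  rw [Nat.factorial_succ]
  push_cast
  field_simp
  ring

lemma hasSum_poisson_mul_sq (r : ℝ≥0) :
    HasSum (fun n : ℕ => Real.exp (-r) * (r : ℝ) ^ n / n.factorial * (n : ℝ) ^ 2)
      (r ^ 2 + r) := by
  rw [← hasSum_nat_add_iff' 1]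
  have h := ((hasSum_poisson_mul r).add (hasSum_one_poissonMeasure r)).mul_left (r : ℝ)
  simp only [Finset.range_one, Finset.sum_singleton, Nat.cast_zero, zero_pow two_ne_zero,
    mul_zero, sub_zero]
  rw [mul_add, mul_one, ← sq] at h
  refine (congrArg (fun f : ℕ → ℝ => HasSum f ((r : ℝ) ^ 2 + r)) (funext fun n => ?_)).mpr h
  rw [Nat.factorial_succ]
  push_cast
  field_simp
  ring

lemma integrable_natCast_poisson (r : ℝ≥0) :
    Integrable (fun n : ℕ => (n : ℝ)) (poissonMeasure r) :=
  integrable_poissonMeasure_iff.2 (by simpa using (hasSum_poisson_mul r).summable)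

lemma integrable_natCast_sq_poisson (r : ℝ≥0) :
    Integrable (fun n : ℕ => (n : ℝ) ^ 2) (poissonMeasure r) :=
  integrable_poissonMeasure_iff.2 (by simpa using (hasSum_poisson_mul_sq r).summable)

lemma integral_natCast_poisson (r : ℝ≥0) : ∫ n, (n : ℝ) ∂poissonMeasure r = r := by
  rw [integral_poissonMeasure]
  exact (hasSum_poisson_mul r).tsum_eq

lemma integral_natCast_sq_poisson (r : ℝ≥0) :
    ∫ n, (n : ℝ) ^ 2 ∂poissonMeasure r = r ^ 2 + r := by
  rw [integral_poissonMeasure]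
  exact (hasSum_poisson_mul_sq r).tsum_eq

lemma integral_pow_poisson (r : ℝ≥0) (z : ℂ) :
    ∫ n, z ^ n ∂poissonMeasure r = Complex.exp (r * (z - 1)) := by
  rw [integral_poissonMeasure]
  calc ∑' n : ℕ, (Real.exp (-r) * (r : ℝ) ^ n / n.factorial) • z ^ n
      = ∑' n : ℕ, (Real.exp (-r) : ℂ) * ((r * z) ^ n / n.factorial) := by
        congr with n
        rw [Complex.real_smul]
        push_cast
        ring
    _ = Complex.exp (r * (z - 1)) := by
        rw [tsum_mul_left, (NormedSpace.expSeries_div_hasSum_exp (r * z : ℂ)).tsum_eq,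
          ← Complex.exp_eq_exp_ℂ, Complex.ofReal_exp, ← Complex.exp_add]
        push_cast
        ring_nf

/-! ### Characteristic functions of random vectors -/

section CharFun

variable {Ω G : Type*} [MeasurableSpace Ω] {P : Measure Ω} [NormedAddCommGroup G]
  [InnerProductSpace ℝ G] [MeasurableSpace G] [BorelSpace G] [SecondCountableTopology G]
  {X : Ω → G}

lemma charFun_map_eq_integral (hX : AEMeasurable X P) (u : G) :
    charFun (P.map X) u = ∫ ω, Complex.exp (inner ℝ (X ω) u * Complex.I) ∂P := by
  rw [charFun_apply, integral_map hX (by fun_prop)]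

lemma integrable_exp_inner [IsFiniteMeasure P] (hX : AEMeasurable X P) (u : G) :
    Integrable (fun ω => Complex.exp (inner ℝ (X ω) u * Complex.I)) P := by
  refine Integrable.of_bound (by fun_prop) 1 (ae_of_all _ fun ω => ?_)
  rw [Complex.norm_exp_ofReal_mul_I]

end CharFun

/-! ### Poisson samples and their random sums -/

/-- A random sum of marks, as a function of the count and the sequence of marks, is measurable. -/
lemma measurable_sum_range {S E : Type*} [MeasurableSpace S] [AddCommMonoid E] [MeasurableSpace E]
    [MeasurableAdd₂ E] {f : S → E} (hf : Measurable f) :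
    Measurable fun p : ℕ × (ℕ → S) => ∑ k ∈ Finset.range p.1, f (p.2 k) :=
  measurable_from_prod_countable_right fun n =>
    show Measurable fun v : ℕ → S => ∑ k ∈ Finset.range n, f (v k) from
      Finset.measurable_fun_sum _ fun k _ => hf.comp (measurable_pi_apply k)

/-- A Poisson sample: a Poisson distributed number `N` with mean `r`, and an independent i.i.d.
sequence of marks `V k` with the law of `V₀`, of which the first `N` are thought of as present. -/
structure IsPoissonSample {Ω S : Type*} [MeasurableSpace Ω] [MeasurableSpace S] (P : Measure Ω)
    (r : ℝ≥0) (N : Ω → ℕ) (V : ℕ → Ω → S) (V₀ : Ω → S) : Prop where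
  measurable_count : Measurable N
  measurable_mark : ∀ k, Measurable (V k)
  measurable_generic : Measurable V₀
  hasLaw_count : HasLaw N (poissonMeasure r) P
  iIndepFun_mark : iIndepFun V P
  identDistrib_mark : ∀ k, IdentDistrib (V k) V₀ P P
  indepFun_count : IndepFun (fun ω k => V k ω) N P

namespace IsPoissonSample

variable {Ω S S' : Type*} [MeasurableSpace Ω] [MeasurableSpace S] [MeasurableSpace S']
  {P : Measure Ω} [IsProbabilityMeasure P] {r : ℝ≥0} {N : Ω → ℕ} {V : ℕ → Ω → S} {V₀ : Ω → S}

omit [IsProbabilityMeasure P] in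
lemma comp (h : IsPoissonSample P r N V V₀) {f : S → S'} (hf : Measurable f) :
    IsPoissonSample P r N (fun k ω => f (V k ω)) (fun ω => f (V₀ ω)) where
  measurable_count := h.measurable_count
  measurable_mark k := hf.comp (h.measurable_mark k)
  measurable_generic := hf.comp h.measurable_generic
  hasLaw_count := h.hasLaw_count
  iIndepFun_mark := h.iIndepFun_mark.comp (fun _ => f) fun _ => hf
  identDistrib_mark k := (h.identDistrib_mark k).comp hf
  indepFun_count := h.indepFun_count.comp (φ := fun v k => f (v k)) (ψ := id)
    (by fun_prop) measurable_id

section Fubini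

variable {E : Type*} [NormedAddCommGroup E] [MeasurableSpace E] [BorelSpace E]
  [SecondCountableTopology E]

lemma map_prodMk (h : IsPoissonSample P r N V V₀) :
    P.map (fun ω => ((fun k => V k ω), N ω)) =
      (P.map fun ω k => V k ω).prod (poissonMeasure r) := by
  have := h.measurable_mark
  have := h.measurable_count
  rw [(indepFun_iff_map_prod_eq_prod_map_map (by fun_prop) (by fun_prop)).1 h.indepFun_count,
    h.hasLaw_count.map_eq]

/-- Tonelli's criterion for a function of a Poisson sample, with the count integrated last. -/
lemma integrable_comp_count (h : IsPoissonSample P r N V V₀) {F : ℕ → (ℕ → S) → E}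
    (hF : ∀ n, Measurable (F n)) (hint : ∀ n, Integrable (fun ω => F n fun k => V k ω) P)
    (hint' : Integrable (fun n => ∫ ω, ‖F n fun k => V k ω‖ ∂P) (poissonMeasure r)) :
    Integrable (fun ω => F (N ω) fun k => V k ω) P := by
  have := h.measurable_mark
  have := h.measurable_count
  have hV : Measurable fun ω k => V k ω := by fun_prop
  have hG : Measurable fun p : (ℕ → S) × ℕ => F p.2 p.1 :=
    measurable_from_prod_countable_left hF
  have key : Integrable (fun p : (ℕ → S) × ℕ => F p.2 p.1)
      ((P.map fun ω k => V k ω).prod (poissonMeasure r)) := by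
    have : IsProbabilityMeasure (P.map fun ω k => V k ω) :=
      Measure.isProbabilityMeasure_map hV.aemeasurable
    rw [integrable_prod_iff' hG.aestronglyMeasurable]
    refine ⟨ae_of_all _ fun n => ?_, ?_⟩
    · exact (integrable_map_measure (hF n).aestronglyMeasurable hV.aemeasurable).2 (hint n)
    · convert hint' using 2 with n
      rw [integral_map hV.aemeasurable (hF n).norm.aestronglyMeasurable]
  rw [← h.map_prodMk] at key
  exact (integrable_map_measure hG.aestronglyMeasurable (by fun_prop)).1 key

lemma integral_comp_count [NormedSpace ℝ E] (h : IsPoissonSample P r N V V₀)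
    {F : ℕ → (ℕ → S) → E} (hF : ∀ n, Measurable (F n))
    (hint : Integrable (fun ω => F (N ω) fun k => V k ω) P) :
    ∫ ω, F (N ω) (fun k => V k ω) ∂P = ∫ n, ∫ ω, F n (fun k => V k ω) ∂P ∂poissonMeasure r := by
  have := h.measurable_mark
  have := h.measurable_count
  have hV : Measurable fun ω k => V k ω := by fun_prop
  have hVN : Measurable fun ω => ((fun k => V k ω), N ω) := by fun_prop
  have hG : Measurable fun p : (ℕ → S) × ℕ => F p.2 p.1 :=
    measurable_from_prod_countable_left hF
  have : IsProbabilityMeasure (P.map fun ω k => V k ω) :=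
    Measure.isProbabilityMeasure_map hV.aemeasurable
  have key := (integrable_map_measure hG.aestronglyMeasurable hVN.aemeasurable).2 hint
  rw [← integral_map (f := fun p : (ℕ → S) × ℕ => F p.2 p.1) hVN.aemeasurable
    hG.aestronglyMeasurable]
  rw [h.map_prodMk] at key ⊢
  rw [integral_prod_symm _ key]
  exact integral_congr_ae (ae_of_all _ fun n =>
    integral_map hV.aemeasurable (hF n).aestronglyMeasurable)

end Fubini

omit [IsProbabilityMeasure P] in
lemma measurable_sum {E : Type*} [AddCommMonoid E] [MeasurableSpace E] [MeasurableAdd₂ E]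
    {V : ℕ → Ω → E} {V₀ : Ω → E} (h : IsPoissonSample P r N V V₀) :
    Measurable fun ω => ∑ k ∈ Finset.range (N ω), V k ω :=
  (measurable_sum_range measurable_id).comp
    (h.measurable_count.prodMk (measurable_pi_lambda _ h.measurable_mark))

/-- The characteristic function of a compound Poisson distribution. -/
lemma charFun_sum {E : Type*} [NormedAddCommGroup E] [InnerProductSpace ℝ E] [MeasurableSpace E]
    [BorelSpace E] [SecondCountableTopology E] {V : ℕ → Ω → E} {V₀ : Ω → E}
    (h : IsPoissonSample P r N V V₀) (t : E) :
    charFun (P.map fun ω => ∑ k ∈ Finset.range (N ω), V k ω) t =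
      Complex.exp (r * (charFun (P.map V₀) t - 1)) := by
  have hm := h.measurable_mark
  have hF (n : ℕ) : Measurable fun v : ℕ → E =>
      Complex.exp (inner ℝ (∑ k ∈ Finset.range n, v k) t * Complex.I) := by fun_prop
  have hS := h.measurable_sum
  rw [charFun_map_eq_integral hS.aemeasurable,
    h.integral_comp_count (F := fun n v =>
      Complex.exp (inner ℝ (∑ k ∈ Finset.range n, v k) t * Complex.I)) hF, ← integral_pow_poisson]
  · refine integral_congr_ae (ae_of_all _ fun n => ?_)
    have hsum : Measurable fun ω => ∑ k ∈ Finset.range n, V k ω := by fun_prop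
    have := congrFun ((h.iIndepFun_mark.restrict (Finset.range n)).charFun_map_fun_finsetSum_eq_prod
      fun k _ => (hm k).aemeasurable) t
    rw [charFun_map_eq_integral hsum.aemeasurable] at this
    simp only [this, (h.identDistrib_mark _).map_eq, Finset.prod_const, Finset.card_range,
      Pi.pow_apply]
  · exact integrable_exp_inner hS.aemeasurable t

/-- Poisson thinning: if no mark contributes to both of the sums over `f` and `g`, these sums are
independent.  Indeed `exp (i (x + y)) - 1 = (exp (i x) - 1) + (exp (i y) - 1)` when `x y = 0`, so
that the exponent of the joint characteristic function splits. -/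
lemma indepFun_sum_sum (h : IsPoissonSample P r N V V₀)
    {E F : Type*} [NormedAddCommGroup E] [InnerProductSpace ℝ E] [MeasurableSpace E]
    [BorelSpace E] [SecondCountableTopology E] [CompleteSpace E]
    [NormedAddCommGroup F] [InnerProductSpace ℝ F] [MeasurableSpace F]
    [BorelSpace F] [SecondCountableTopology F] [CompleteSpace F]
    {f : S → E} {g : S → F} (hf : Measurable f) (hg : Measurable g)
    (hfg : ∀ s, f s = 0 ∨ g s = 0) :
    IndepFun (fun ω => ∑ k ∈ Finset.range (N ω), f (V k ω))
      (fun ω => ∑ k ∈ Finset.range (N ω), g (V k ω)) P := by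
  have hV₀ := h.measurable_generic
  have hfV : Measurable fun ω => f (V₀ ω) := by fun_prop
  have hgV : Measurable fun ω => g (V₀ ω) := by fun_prop
  have hpair : Measurable fun s => WithLp.toLp 2 (f s, g s) := by fun_prop
  have hpairV : Measurable fun ω => WithLp.toLp 2 (f (V₀ ω), g (V₀ ω)) := by fun_prop
  rw [indepFun_iff_charFun_prod (h.comp hf).measurable_sum.aemeasurable
    (h.comp hg).measurable_sum.aemeasurable]
  intro t
  have hsum : (fun ω => WithLp.toLp 2 (∑ k ∈ Finset.range (N ω), f (V k ω),
      ∑ k ∈ Finset.range (N ω), g (V k ω))) =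
      fun ω => ∑ k ∈ Finset.range (N ω), WithLp.toLp 2 (f (V k ω), g (V k ω)) := by
    ext ω
    refine WithLp.ofLp_injective 2 (Prod.ext ?_ ?_) <;>
      simp [WithLp.ofLp_sum, Prod.fst_sum, Prod.snd_sum]
  rw [hsum, (h.comp hpair).charFun_sum, (h.comp hf).charFun_sum, (h.comp hg).charFun_sum,
    ← Complex.exp_add, ← mul_add]
  congr 2
  rw [charFun_map_eq_integral hpairV.aemeasurable, charFun_map_eq_integral hfV.aemeasurable,
    charFun_map_eq_integral hgV.aemeasurable]
  have hpt (ω : Ω) : Complex.exp (inner ℝ (WithLp.toLp 2 (f (V₀ ω), g (V₀ ω))) t * Complex.I) =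
      Complex.exp (inner ℝ (f (V₀ ω)) t.ofLp.1 * Complex.I) +
        Complex.exp (inner ℝ (g (V₀ ω)) t.ofLp.2 * Complex.I) - 1 := by
    rcases hfg (V₀ ω) with h0 | h0 <;> simp [h0, WithLp.prod_inner_apply]
  simp_rw [hpt]
  have hf1 := integrable_exp_inner (P := P) hfV.aemeasurable t.ofLp.1
  have hg1 := integrable_exp_inner (P := P) hgV.aemeasurable t.ofLp.2
  rw [integral_sub (f := fun ω => _ + _) (hf1.add hg1) (integrable_const _),
    integral_add hf1 hg1]
  simp
  ring

section Moments

variable {W : ℕ → Ω → ℝ} {W₀ : Ω → ℝ}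

omit [IsProbabilityMeasure P] in
lemma memLp_mark (h : IsPoissonSample P r N W W₀) (h2 : MemLp W₀ 2 P) (k : ℕ) :
    MemLp (W k) 2 P := (h.identDistrib_mark k).memLp_iff.2 h2

lemma integral_partialSum (h : IsPoissonSample P r N W W₀) (h2 : MemLp W₀ 2 P) (n : ℕ) :
    ∫ ω, ∑ k ∈ Finset.range n, W k ω ∂P = n * ∫ ω, W₀ ω ∂P := by
  rw [integral_finsetSum _ fun k _ => (h.memLp_mark h2 k).integrable one_le_two]
  simp [(h.identDistrib_mark _).integral_eq]

lemma integral_partialSum_sq (h : IsPoissonSample P r N W W₀) (h2 : MemLp W₀ 2 P) (n : ℕ) :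
    ∫ ω, (∑ k ∈ Finset.range n, W k ω) ^ 2 ∂P =
      n * Var[W₀; P] + (n : ℝ) ^ 2 * (∫ ω, W₀ ω ∂P) ^ 2 := by
  have hL : MemLp (∑ k ∈ Finset.range n, W k) 2 P :=
    memLp_finsetSum' _ fun k _ => h.memLp_mark h2 k
  have h1 := variance_eq_sub hL
  rw [IndepFun.variance_sum (fun k _ => h.memLp_mark h2 k)
    (fun k _ l _ hkl => h.iIndepFun_mark.indepFun hkl)] at h1
  simp only [(h.identDistrib_mark _).variance_eq, Finset.sum_const, Finset.card_range,
    nsmul_eq_mul, Pi.pow_apply, Finset.sum_apply, h.integral_partialSum h2] at h1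
  linarith

lemma memLp_sum (h : IsPoissonSample P r N W W₀) (h2 : MemLp W₀ 2 P) :
    MemLp (fun ω => ∑ k ∈ Finset.range (N ω), W k ω) 2 P := by
  rw [memLp_two_iff_integrable_sq h.measurable_sum.aestronglyMeasurable]
  refine h.integrable_comp_count (F := fun n v => (∑ k ∈ Finset.range n, v k) ^ 2)
    (fun n => by fun_prop) (fun n => ?_) ?_
  · exact (memLp_finsetSum _ fun k _ => h.memLp_mark h2 k).integrable_sq
  · simp only [norm_pow, Real.norm_eq_abs, sq_abs, h.integral_partialSum_sq h2]
    exact ((integrable_natCast_poisson r).mul_const _).add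
      ((integrable_natCast_sq_poisson r).mul_const _)

lemma integral_sum (h : IsPoissonSample P r N W W₀) (h2 : MemLp W₀ 2 P) :
    ∫ ω, ∑ k ∈ Finset.range (N ω), W k ω ∂P = r * ∫ ω, W₀ ω ∂P := by
  rw [h.integral_comp_count (F := fun n v => ∑ k ∈ Finset.range n, v k) (fun n => by fun_prop)
    ((h.memLp_sum h2).integrable one_le_two)]
  simp only [h.integral_partialSum h2]
  rw [integral_mul_const, integral_natCast_poisson]

lemma integral_sum_sq (h : IsPoissonSample P r N W W₀) (h2 : MemLp W₀ 2 P) :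
    ∫ ω, (∑ k ∈ Finset.range (N ω), W k ω) ^ 2 ∂P =
      r * ∫ ω, W₀ ω ^ 2 ∂P + (r * ∫ ω, W₀ ω ∂P) ^ 2 := by
  rw [h.integral_comp_count (F := fun n v => (∑ k ∈ Finset.range n, v k) ^ 2)
    (fun n => by fun_prop) (h.memLp_sum h2).integrable_sq]
  simp only [h.integral_partialSum_sq h2]
  rw [integral_add ((integrable_natCast_poisson r).mul_const _)
    ((integrable_natCast_sq_poisson r).mul_const _), integral_mul_const, integral_mul_const,
    integral_natCast_poisson, integral_natCast_sq_poisson, variance_eq_sub h2]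
  simp only [Pi.pow_apply]
  ring

lemma variance_sum (h : IsPoissonSample P r N W W₀) (h2 : MemLp W₀ 2 P) :
    Var[fun ω => ∑ k ∈ Finset.range (N ω), W k ω; P] = r * ∫ ω, W₀ ω ^ 2 ∂P := by
  rw [variance_eq_sub (h.memLp_sum h2)]
  simp only [Pi.pow_apply, h.integral_sum_sq h2, h.integral_sum h2]
  ring

end Moments

end IsPoissonSample

/-! ### Conditional expectations in the extended sense -/

section CondExp

variable {Ω : Type*} {m m₀ : MeasurableSpace Ω} {P : Measure Ω}

lemma IsCondExp.ae_eq [IsFiniteMeasure P] (hm : m ≤ m₀) {X Y Y' : Ω → ℝ}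
    (hY : IsCondExp m P X Y) (hY' : IsCondExp m P X Y') : Y =ᵐ[P] Y' := by
  obtain ⟨A, hA, hAu, hAn⟩ := hY.exists_cover
  obtain ⟨A', hA', hAu', hAn'⟩ := hY'.exists_cover
  have key (p : ℕ × ℕ) : Y =ᵐ[P.restrict (A p.1 ∩ A' p.2)] Y' := by
    have hi : IntegrableOn Y (A p.1 ∩ A' p.2) P := (hAn p.1).2.1.mono_set Set.inter_subset_left
    have hi' : IntegrableOn Y' (A p.1 ∩ A' p.2) P :=
      (hAn' p.2).2.1.mono_set Set.inter_subset_right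
    refine ae_eq_of_forall_setIntegral_eq_of_sigmaFinite' hm (fun s _ _ => hi.integrableOn)
      (fun s _ _ => hi'.integrableOn) (fun s hs _ => ?_)
      hY.measurable.stronglyMeasurable.aestronglyMeasurable
      hY'.measurable.stronglyMeasurable.aestronglyMeasurable
    have hB : MeasurableSet[m] (s ∩ (A p.1 ∩ A' p.2)) := hs.inter ((hA _).inter (hA' _))
    rw [Measure.restrict_restrict (hm _ hs),
      (hAn p.1).2.2 _ hB (Set.inter_subset_right.trans Set.inter_subset_left),
      (hAn' p.2).2.2 _ hB (Set.inter_subset_right.trans Set.inter_subset_right)]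
  have hU : (⋃ p : ℕ × ℕ, A p.1 ∩ A' p.2) = Set.univ := by
    refine Set.eq_univ_of_forall fun ω => ?_
    obtain ⟨n, hn⟩ := Set.mem_iUnion.1 (hAu ▸ Set.mem_univ ω)
    obtain ⟨k, hk⟩ := Set.mem_iUnion.1 (hAu' ▸ Set.mem_univ ω)
    exact Set.mem_iUnion.2 ⟨(n, k), hn, hk⟩
  have := (ae_restrict_iUnion_iff (μ := P) (fun p : ℕ × ℕ => A p.1 ∩ A' p.2)
    fun ω => Y ω = Y' ω).2 key
  rwa [hU, Measure.restrict_univ] at this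

lemma integrableOn_of_bound [IsFiniteMeasure P] (hm : m ≤ m₀) {Y : Ω → ℝ} (hY : Measurable[m] Y)
    {B : Set Ω} (hB : MeasurableSet[m] B) {K : ℝ} (hK : ∀ ω ∈ B, |Y ω| ≤ K) :
    IntegrableOn Y B P :=
  Measure.integrableOn_of_bounded (measure_ne_top _ _) (hY.mono hm le_rfl).aestronglyMeasurable
    ((ae_restrict_iff' (hm _ hB)).2 (ae_of_all _ fun ω hω => hK ω hω))

section Indep

variable {X Y : Ω → ℝ}

lemma indepFun_indicator (hind : Indep (MeasurableSpace.comap X inferInstance) m P)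
    (hY : Measurable[m] Y) {B : Set Ω} (hB : MeasurableSet[m] B) :
    IndepFun X (B.indicator Y) P :=
  (IndepFun_iff_Indep _ _ _).2 (indep_of_indep_of_le_right hind
    (Measurable.indicator hY hB).comap_le)

lemma integrableOn_mul_of_indep (hm : m ≤ m₀) {f : ℝ → ℝ} (hf : Measurable f)
    (hfX : Integrable (fun ω => f (X ω)) P)
    (hind : Indep (MeasurableSpace.comap X inferInstance) m P) (hY : Measurable[m] Y)
    {B : Set Ω} (hB : MeasurableSet[m] B) (hYB : IntegrableOn Y B P) :
    IntegrableOn (fun ω => f (X ω) * Y ω) B P := by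
  rw [← integrable_indicator_iff (hm _ hB)] at hYB ⊢
  have := ((indepFun_indicator hind hY hB).comp hf measurable_id).integrable_mul hfX hYB
  refine this.congr (ae_of_all _ fun ω => ?_)
  by_cases h : ω ∈ B <;> simp [h]

lemma setIntegral_mul_of_indep (hm : m ≤ m₀) {f : ℝ → ℝ} (hf : Measurable f)
    (hX : Measurable X)
    (hind : Indep (MeasurableSpace.comap X inferInstance) m P) (hY : Measurable[m] Y)
    {B : Set Ω} (hB : MeasurableSet[m] B) :
    ∫ ω in B, f (X ω) * Y ω ∂P = (∫ ω, f (X ω) ∂P) * ∫ ω in B, Y ω ∂P := by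
  have h := (indepFun_indicator hind hY hB).integral_fun_comp_mul_comp (f := f) (g := fun y => y)
    hX.aemeasurable ((hY.mono hm le_rfl).indicator (hm _ hB)).aemeasurable
    hf.aestronglyMeasurable measurable_id.aestronglyMeasurable
  rw [← integral_indicator (hm _ hB), ← integral_indicator (hm _ hB), ← h]
  refine integral_congr_ae (ae_of_all _ fun ω => ?_)
  by_cases h : ω ∈ B <;> simp [h]

/-- If `X` is square integrable and independent of `m`, while `C` is `m`-measurable, then
`(X - d C)² / C` has the conditional expectation `(Var X + (E X - d C)²) / C`.  The exhausting sets
are those on which both `C` and `1 / C` are bounded by `n`. -/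
lemma isCondExp_sq_sub_div [IsProbabilityMeasure P] (hm : m ≤ m₀) {C : Ω → ℝ} (hX : Measurable X)
    (hX2 : MemLp X 2 P)
    (hind : Indep (MeasurableSpace.comap X inferInstance) m P) (hC : Measurable[m] C) (d : ℝ) :
    IsCondExp m P (fun ω => (X ω - d * C ω) ^ 2 / C ω)
      (fun ω => (Var[X; P] + ((∫ ω', X ω' ∂P) - d * C ω) ^ 2) / C ω) where
  measurable := by fun_prop
  exists_cover := by
    have hCinv : Measurable[m] fun ω => (C ω)⁻¹ := hC.inv
    have hCC : Measurable[m] fun ω => C ω * (C ω)⁻¹ := hC.mul hCinv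
    have hAm (n : ℕ) : MeasurableSet[m] {ω | |C ω| ≤ n ∧ |(C ω)⁻¹| ≤ n} := by
      have hS : MeasurableSet {x : ℝ | |x| ≤ n ∧ |x⁻¹| ≤ n} :=
        (measurableSet_le (f := fun x : ℝ => |x|) (by fun_prop) measurable_const).inter
          (measurableSet_le (f := fun x : ℝ => |x⁻¹|) (by fun_prop) measurable_const)
      exact hC hS
    refine ⟨fun n => {ω | |C ω| ≤ n ∧ |(C ω)⁻¹| ≤ n}, fun n => ?_, ?_, fun n => ?_⟩
    · exact hAm n
    · refine Set.eq_univ_of_forall fun ω => Set.mem_iUnion.2 ?_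
      obtain ⟨n, hn⟩ := exists_nat_ge (max |C ω| |(C ω)⁻¹|)
      exact ⟨n, (le_max_left _ _).trans hn, (le_max_right _ _).trans hn⟩
    have hX1 : Integrable X P := hX2.integrable one_le_two
    have hXsq : Integrable (fun ω => X ω ^ 2) P := hX2.integrable_sq
    -- these pointwise expansions also hold where `C` vanishes, both sides being `0` there
    have hexp (ω : Ω) : (X ω - d * C ω) ^ 2 / C ω =
        X ω ^ 2 * (C ω)⁻¹ - 2 * d * (X ω * (C ω * (C ω)⁻¹)) + d ^ 2 * C ω := by
      by_cases h : C ω = 0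
      · simp [h]
      · field_simp
        ring
    set x := ∫ ω, X ω ∂P with hx
    have hexp' (ω : Ω) : (Var[X; P] + (x - d * C ω) ^ 2) / C ω =
        (∫ ω', X ω' ^ 2 ∂P) * (C ω)⁻¹ - 2 * d * (x * (C ω * (C ω)⁻¹)) + d ^ 2 * C ω := by
      have hv : Var[X; P] = (∫ ω', X ω' ^ 2 ∂P) - x ^ 2 := variance_eq_sub hX2
      by_cases h : C ω = 0
      · simp [h]
      · rw [hv]
        field_simp
        ring
    have main (B : Set Ω) (hB : MeasurableSet[m] B) (hBn : ∀ ω ∈ B, |C ω| ≤ n ∧ |(C ω)⁻¹| ≤ n) :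
        IntegrableOn (fun ω => (X ω - d * C ω) ^ 2 / C ω) B P ∧
        IntegrableOn (fun ω => (Var[X; P] + (x - d * C ω) ^ 2) / C ω) B P ∧
        ∫ ω in B, (Var[X; P] + (x - d * C ω) ^ 2) / C ω ∂P =
          ∫ ω in B, (X ω - d * C ω) ^ 2 / C ω ∂P := by
      have b1 : IntegrableOn C B P := integrableOn_of_bound hm hC hB fun ω hω => (hBn ω hω).1
      have b2 : IntegrableOn (fun ω => (C ω)⁻¹) B P :=
        integrableOn_of_bound hm hCinv hB fun ω hω => (hBn ω hω).2
      have b3 : IntegrableOn (fun ω => C ω * (C ω)⁻¹) B P := by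
        refine integrableOn_of_bound (K := 1) hm hCC hB fun ω _ => ?_
        by_cases h : C ω = 0 <;> simp [h]
      have i1 := integrableOn_mul_of_indep hm (f := fun y => y ^ 2) (by fun_prop) hXsq hind hCinv
        hB b2
      have i2 := integrableOn_mul_of_indep hm measurable_id hX1 hind hCC hB b3
      have s1 := setIntegral_mul_of_indep hm (f := fun y => y ^ 2) (by fun_prop) hX hind hCinv hB
      have s2 := setIntegral_mul_of_indep hm measurable_id hX hind hCC hB
      simp only [id] at i2 s2
      simp only [hexp, hexp']
      refine ⟨(i1.sub (i2.const_mul _)).add (b1.const_mul _),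
        ((b2.const_mul _).sub ((b3.const_mul _).const_mul _)).add (b1.const_mul _), ?_⟩
      have j1 : IntegrableOn (fun ω => X ω ^ 2 * (C ω)⁻¹ - 2 * d * (X ω * (C ω * (C ω)⁻¹))) B P :=
        i1.sub (i2.const_mul _)
      have j2 : IntegrableOn (fun ω => (∫ ω', X ω' ^ 2 ∂P) * (C ω)⁻¹ -
          2 * d * (x * (C ω * (C ω)⁻¹))) B P := (b2.const_mul _).sub ((b3.const_mul _).const_mul _)
      rw [integral_add j1 (b1.const_mul _), integral_add j2 (b1.const_mul _),
        integral_sub i1 (i2.const_mul _),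
        integral_sub (b2.const_mul _) ((b3.const_mul _).const_mul _)]
      simp only [integral_const_mul, s1, s2, hx]
    obtain ⟨h1, h2, -⟩ := main _ (hAm n) fun ω hω => hω
    exact ⟨h1, h2, fun B hB hBA => (main B hB fun ω hω => hBA hω).2.2⟩

end Indep

end CondExp

/-! ### Independence of σ-algebras generated by pairs -/

/-- If `X` is independent of `V` and the pair `(X, V)` is independent of `O`, then `X` is
independent of the pair `(V, O)`. -/
lemma _root_.ProbabilityTheory.IndepFun.prodMk_right_of_prodMk_left
    {Ω α β γ : Type*} [MeasurableSpace Ω] [MeasurableSpace α]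
    [MeasurableSpace β] [MeasurableSpace γ] {P : Measure Ω} [IsProbabilityMeasure P]
    {X : Ω → α} {V : Ω → β} {O : Ω → γ} (hX : Measurable X) (hV : Measurable V)
    (hO : Measurable O) (hXV : IndepFun X V P) (hXVO : IndepFun (fun ω => (X ω, V ω)) O P) :
    IndepFun X (fun ω => (V ω, O ω)) P := by
  have hVO : IndepFun V O P := hXVO.comp measurable_snd measurable_id
  rw [indepFun_iff_map_prod_eq_prod_map_map (by fun_prop) (by fun_prop)] at hXV hXVO hVO ⊢
  have := Measure.isProbabilityMeasure_map (μ := P) hX.aemeasurable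
  have := Measure.isProbabilityMeasure_map (μ := P) hV.aemeasurable
  have := Measure.isProbabilityMeasure_map (μ := P) hO.aemeasurable
  rw [hVO, ← Measure.prodAssoc_prod, ← hXV, ← hXVO, Measure.map_map (by fun_prop) (by fun_prop)]
  rfl

/-! ### Convergence in probability and in distribution -/

section Convergence

variable {Ω Ω' Ω'' : Type*} [MeasurableSpace Ω] [MeasurableSpace Ω'] [MeasurableSpace Ω'']
  {P : Measure Ω} {P' : Measure Ω'} {P'' : Measure Ω''}

lemma tendstoInMeasure_comp_const {ι E F : Type*} [PseudoEMetricSpace E] [PseudoEMetricSpace F]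
    {l : Filter ι} {Y : ι → Ω → E} {c : E} (hY : TendstoInMeasure P Y l fun _ => c) {f : E → F}
    (hf : ContinuousAt f c) :
    TendstoInMeasure P (fun a ω => f (Y a ω)) l fun _ => f c := by
  intro ε hε
  obtain ⟨δ, hδ, hδε⟩ := EMetric.tendsto_nhds_nhds.1 hf ε hε
  refine tendsto_of_tendsto_of_tendsto_of_le_of_le tendsto_const_nhds (hY δ hδ)
    (fun _ => zero_le) fun a => measure_mono fun ω hω => ?_
  by_contra hlt
  exact (hδε (not_le.1 hlt)).not_ge hω

/-- Convergence in distribution only depends on the eventual variables up to almost sure equality,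
and on the law of the limit. -/
lemma tendstoInDistribution_congr [IsProbabilityMeasure P] [IsProbabilityMeasure P']
    [IsProbabilityMeasure P''] {ι : Type*} {l : Filter ι} {X Y : ι → Ω → ℝ} {Z' : Ω' → ℝ}
    {Z'' : Ω'' → ℝ} (h : TendstoInDistribution X l Z' (fun _ => P) P')
    (hY : ∀ a, AEMeasurable (Y a) P) (hXY : ∀ᶠ a in l, X a =ᵐ[P] Y a)
    (hZ : AEMeasurable Z'' P'') (hZZ : P'.map Z' = P''.map Z'') :
    TendstoInDistribution Y l Z'' (fun _ => P) P'' where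
  forall_aemeasurable := hY
  aemeasurable_limit := hZ
  tendsto := by
    have hlim : (⟨P'.map Z', Measure.isProbabilityMeasure_map h.aemeasurable_limit⟩ :
        ProbabilityMeasure ℝ) = ⟨P''.map Z'', Measure.isProbabilityMeasure_map hZ⟩ :=
      Subtype.ext hZZ
    rw [← hlim]
    refine h.tendsto.congr' ?_
    filter_upwards [hXY] with a ha
    exact Subtype.ext (Measure.map_congr ha)

/-- The second order expansion of the characteristic function at `0`, on the scale of the central
limit theorem. -/
lemma tendsto_mul_charFun_sub [IsProbabilityMeasure P] {W : Ω → ℝ} (hW : AEMeasurable W P)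
    (h2 : MemLp W 2 P) (u : ℝ) :
    Tendsto (fun a : ℝ => (a : ℂ) * (charFun (P.map W) ((√a)⁻¹ * u) - 1 -
      (∫ ω, W ω ∂P : ℝ) * ((√a)⁻¹ * u : ℝ) * Complex.I)) atTop
      (𝓝 (-((∫ ω, W ω ^ 2 ∂P : ℝ) * u ^ 2 / 2))) := by
  have : IsProbabilityMeasure (P.map W) := Measure.isProbabilityMeasure_map hW
  have hid : MemLp id 2 (P.map W) := by
    rw [memLp_map_measure_iff (by fun_prop) hW]
    exact h2
  have ho := taylor_isLittleO_univ (n := 2) (x₀ := 0) (contDiff_charFun (μ := P.map W) hid)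
  simp only [taylorWithinEval_charFun_two_zero hW hid, sub_zero] at ho
  have hs : Tendsto (fun a : ℝ => (√a)⁻¹ * u) atTop (𝓝 0) := by
    rw [← zero_mul u]
    exact (tendsto_inv_atTop_zero.comp Real.tendsto_sqrt_atTop).mul_const u
  have hpos (a : ℝ) (ha : 0 < a) : a * ((√a)⁻¹ * u) ^ 2 = u ^ 2 := by
    rw [mul_pow, inv_pow, Real.sq_sqrt ha.le]
    field_simp
  have ha : (fun a : ℝ => (a : ℂ)) =O[atTop] fun a : ℝ => a :=
    Asymptotics.IsBigO.of_bound 1 (.of_forall fun a => by simp)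
  have ho' := ha.mul_isLittleO (ho.comp_tendsto hs)
  have hO : (fun a : ℝ => a * ((fun x : ℝ => x ^ 2) ∘ fun a => (√a)⁻¹ * u) a) =O[atTop]
      fun _ => (1 : ℝ) := by
    refine Asymptotics.IsBigO.of_bound (u ^ 2) ?_
    filter_upwards [eventually_gt_atTop 0] with a ha
    simp [hpos a ha]
  have hlim := ((Asymptotics.isLittleO_one_iff ℝ).1 (ho'.trans_isBigO hO)).sub_const
    ((∫ ω, W ω ^ 2 ∂P : ℝ) * u ^ 2 / 2 : ℂ)
  rw [zero_sub] at hlim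
  refine hlim.congr' ?_
  filter_upwards [eventually_gt_atTop 0] with a ha
  have hc : (a : ℂ) * ((√a)⁻¹ * u : ℝ) ^ 2 = (u : ℂ) ^ 2 := by exact_mod_cast hpos a ha
  rw [← hc]
  simp only [Function.comp_apply, Pi.pow_apply]
  push_cast
  ring

/-- The central limit theorem for compound Poisson sums of increasing intensity. -/
lemma tendstoInDistribution_poissonSum [IsProbabilityMeasure P] {r : ℝ≥0} {N : ℝ≥0 → Ω → ℕ}
    {W : ℕ → Ω → ℝ} {W₀ : Ω → ℝ} (h : ∀ a, IsPoissonSample P (r * a) (N a) W W₀)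
    (h2 : MemLp W₀ 2 P) :
    TendstoInDistribution (fun (a : ℝ≥0) ω => (√a)⁻¹ * (∑ k ∈ Finset.range (N a ω), W k ω -
        r * a * ∫ ω, W₀ ω ∂P)) atTop
      (fun x : ℝ => √(r * ∫ ω, W₀ ω ^ 2 ∂P) * x) (fun _ => P) (gaussianReal 0 1) where
  forall_aemeasurable a := by
    exact (((h a).measurable_sum.sub_const _).const_mul _).aemeasurable
  tendsto := by
    refine tendsto_of_seq_tendsto fun x hx => ProbabilityMeasure.tendsto_of_tendsto_charFun
      fun u => ?_
    have hlim : charFun ((gaussianReal 0 1).map fun x => √(r * ∫ ω, W₀ ω ^ 2 ∂P) * x) u =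
        Complex.exp (r * -((∫ ω, W₀ ω ^ 2 ∂P : ℝ) * u ^ 2 / 2)) := by
      have hv : (0 : ℝ) ≤ r * ∫ ω, W₀ ω ^ 2 ∂P :=
        mul_nonneg r.2 (integral_nonneg fun ω => sq_nonneg _)
      rw [charFun_map_mul_comp (f := fun x : ℝ => x) (by fun_prop), Measure.map_id',
        charFun_gaussianReal]
      congr 1
      push_cast
      rw [mul_pow, ← Complex.ofReal_pow, Real.sq_sqrt hv]
      push_cast
      ring
    have hcf (a : ℝ≥0) : charFun (P.map fun ω => (√a)⁻¹ * (∑ k ∈ Finset.range (N a ω), W k ω -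
        r * a * ∫ ω, W₀ ω ∂P)) u = Complex.exp (r * ((a : ℝ) *
          (charFun (P.map W₀) ((√a)⁻¹ * u) - 1 -
            (∫ ω, W₀ ω ∂P : ℝ) * ((√a)⁻¹ * u : ℝ) * Complex.I))) := by
      have hS := (h a).measurable_sum
      have hcs := (h a).charFun_sum ((√a)⁻¹ * u)
      rw [charFun_map_eq_integral hS.aemeasurable] at hcs
      rw [charFun_map_mul_comp (hS.sub_const _).aemeasurable,
        charFun_map_eq_integral (hS.sub_const _).aemeasurable]
      have hpt (ω : Ω) : Complex.exp (inner ℝ (∑ k ∈ Finset.range (N a ω), W k ω -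
          r * a * ∫ ω, W₀ ω ∂P) ((√a)⁻¹ * u) * Complex.I) =
          Complex.exp (inner ℝ (∑ k ∈ Finset.range (N a ω), W k ω) ((√a)⁻¹ * u) * Complex.I) *
          Complex.exp (-(r * a * (∫ ω, W₀ ω ∂P : ℝ) * ((√a)⁻¹ * u : ℝ) * Complex.I)) := by
        rw [← Complex.exp_add, inner_sub_left]
        congr 1
        simp only [Real.inner_apply]
        push_cast
        ring
      simp only [hpt]
      rw [integral_mul_const, hcs, ← Complex.exp_add]
      congr 1
      push_cast
      ring
    change Tendsto (fun n => charFun (P.map fun ω => (√(x n : ℝ))⁻¹ *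
      (∑ k ∈ Finset.range (N (x n) ω), W k ω - r * x n * ∫ ω, W₀ ω ∂P)) u) atTop
      (𝓝 (charFun ((gaussianReal 0 1).map fun x => √(r * ∫ ω, W₀ ω ^ 2 ∂P) * x) u))
    simp only [hlim, hcf]
    have hx' : Tendsto (fun n => (x n : ℝ)) atTop atTop := NNReal.tendsto_coe_atTop.2 hx
    exact (Complex.continuous_exp.tendsto _).comp
      (((tendsto_mul_charFun_sub (h 0).measurable_generic.aemeasurable h2 u).comp hx').const_mul _)

/-- The weak law of large numbers for compound Poisson sums of increasing intensity. -/
lemma tendstoInMeasure_poissonSum_div [IsProbabilityMeasure P] {r : ℝ≥0} {N : ℝ≥0 → Ω → ℕ}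
    {W : ℕ → Ω → ℝ} {W₀ : Ω → ℝ} (h : ∀ a, IsPoissonSample P (r * a) (N a) W W₀)
    (h2 : MemLp W₀ 2 P) :
    TendstoInMeasure P (fun (a : ℝ≥0) ω => (∑ k ∈ Finset.range (N a ω), W k ω) / a) atTop
      fun _ => r * ∫ ω, W₀ ω ∂P := by
  rw [tendstoInMeasure_iff_dist]
  intro ε hε
  have hlim : Tendsto (fun a : ℝ≥0 => ENNReal.ofReal
      (r * (∫ ω, W₀ ω ^ 2 ∂P) / ε ^ 2 * (a : ℝ)⁻¹)) atTop (𝓝 0) := by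
    rw [← ENNReal.ofReal_zero]
    refine ENNReal.tendsto_ofReal ?_
    rw [← mul_zero (r * (∫ ω, W₀ ω ^ 2 ∂P) / ε ^ 2)]
    exact (tendsto_inv_atTop_zero.comp (NNReal.tendsto_coe_atTop.2 tendsto_id)).const_mul _
  refine tendsto_of_tendsto_of_tendsto_of_le_of_le' tendsto_const_nhds hlim
    (.of_forall fun _ => zero_le) ?_
  filter_upwards [eventually_gt_atTop 0] with a ha
  have ha' : (0 : ℝ) < a := ha
  have hc := meas_ge_le_variance_div_sq ((h a).memLp_sum h2) (mul_pos hε ha')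
  rw [(h a).integral_sum h2, (h a).variance_sum h2] at hc
  refine (measure_mono fun ω hω => ?_).trans (hc.trans_eq ?_)
  · simp only [Set.mem_ofPred_eq, Real.dist_eq] at hω ⊢
    refine ((le_div_iff₀ ha').1 (hω.trans_eq ?_))
    nth_rw 2 [← abs_of_pos ha']
    rw [← abs_div]
    congr 1
    push_cast
    field_simp
  · congr 1
    push_cast
    field_simp

end Convergence

/-! ### The special model as a family of Poisson samples -/

namespace SpecialModel

variable {Ω : Type*} [MeasurableSpace Ω] {P : Measure Ω} [IsProbabilityMeasure P] {T : ℕ}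
  {lam : ℕ → ℝ≥0} {M : ℕ → ℝ≥0 → Ω → ℕ} {D : ℕ → ℕ → Ω → ℕ} {Z : ℕ → ℕ → Ω → ℝ} {D₀ : Ω → ℕ}
  {Z₀ : Ω → ℝ}

omit [IsProbabilityMeasure P] in
lemma hasLaw_count (h : SpecialModel P T lam M D Z D₀ Z₀) {i : ℕ} (hi : i ∈ Finset.Icc 1 T)
    (a : ℝ≥0) : HasLaw (M i a) (poissonMeasure (lam i * a)) P := by
  have hl := (h.poisson i hi).law_increment 0 a zero_le
  rw [tsub_zero] at hl
  refine hl.congr ?_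
  filter_upwards [(h.poisson i hi).zero] with ω hω
  simp [hω]

omit [IsProbabilityMeasure P] in
lemma isPoissonSample (h : SpecialModel P T lam M D Z D₀ Z₀) {i : ℕ} (hi : i ∈ Finset.Icc 1 T)
    (a : ℝ≥0) :
    IsPoissonSample P (lam i * a) (M i a) (fun k ω => (D i k ω, Z i k ω))
      (fun ω => (D₀ ω, Z₀ ω)) where
  measurable_count := (h.poisson i hi).measurable a
  measurable_mark k := (h.measurable_D i hi k).prodMk (h.measurable_Z i hi k)
  measurable_generic := h.measurable_D₀.prodMk h.measurable_Z₀
  hasLaw_count := h.hasLaw_count hi a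
  iIndepFun_mark := h.indep_claims i hi
  identDistrib_mark := h.identDistrib i hi
  indepFun_count := h.indep_count i hi a

end SpecialModel

/-- The contribution of a claim with development year `p.1` and size `p.2` to the accumulated
claims up to development year `s`. -/
noncomputable def earlyMark (s : ℕ) (p : ℕ × ℝ) : ℝ := if p.1 ≤ s then p.2 else 0

/-- The contribution of a claim with development year `p.1` and size `p.2` to the claims of the
development years in `(t, T]`. -/
noncomputable def lateMark (t T : ℕ) (p : ℕ × ℝ) : ℝ := if t < p.1 ∧ p.1 ≤ T then p.2 else 0

lemma measurable_earlyMark (s : ℕ) : Measurable (earlyMark s) :=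
  Measurable.ite (measurable_fst (measurableSet_Iic (a := s))) measurable_snd measurable_const

lemma measurable_lateMark (t T : ℕ) : Measurable (lateMark t T) :=
  Measurable.ite (measurable_fst (measurableSet_Ioc (a := t) (b := T))) measurable_snd
    measurable_const

section Observed

variable {Ω : Type*} [MeasurableSpace Ω] {P : Measure Ω} [IsProbabilityMeasure P] {T : ℕ}
  {lam : ℕ → ℝ≥0} {M : ℕ → ℝ≥0 → Ω → ℕ} {D : ℕ → ℕ → Ω → ℕ} {Z : ℕ → ℕ → Ω → ℝ} {D₀ : Ω → ℕ}
  {Z₀ : Ω → ℝ}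

omit [MeasurableSpace Ω] in
lemma cumClaims_eq_sum_earlyMark (i s : ℕ) (a : ℝ≥0) (ω : Ω) :
    cumClaims M D Z i s a ω =
      ∑ k ∈ Finset.range (M i a ω), earlyMark s (D i k ω, Z i k ω) := rfl

omit [MeasurableSpace Ω] in
lemma cumClaims_eq_add_lateMark {i t T : ℕ} (htT : t ≤ T) (a : ℝ≥0) (ω : Ω) :
    cumClaims M D Z i T a ω = cumClaims M D Z i t a ω +
      ∑ k ∈ Finset.range (M i a ω), lateMark t T (D i k ω, Z i k ω) := by
  rw [cumClaims, cumClaims, ← Finset.sum_add_distrib]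
  refine Finset.sum_congr rfl fun k _ => ?_
  unfold lateMark
  split_ifs <;> first | omega | simp

omit [IsProbabilityMeasure P] in
lemma SpecialModel.measurable_cumClaims (h : SpecialModel P T lam M D Z D₀ Z₀) {i : ℕ}
    (hi : i ∈ Finset.Icc 1 T) (s : ℕ) (a : ℝ≥0) : Measurable (cumClaims M D Z i s a) :=
  ((h.isPoissonSample hi a).comp (measurable_earlyMark s)).measurable_sum

omit [IsProbabilityMeasure P] in
lemma SpecialModel.observed_le (h : SpecialModel P T lam M D Z D₀ Z₀) (a : ℝ≥0) :
    observed T M D Z a ≤ ‹MeasurableSpace Ω› :=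
  iSup₂_le fun _ hj => iSup₂_le fun s _ => iSup_le fun _ => (h.measurable_cumClaims hj s a).comap_le

omit [MeasurableSpace Ω] in
lemma measurable_cumClaims_observed {j s : ℕ} (hj : j ∈ Finset.Icc 1 T) (hs : s ∈ Finset.Icc 1 T)
    (hjs : j + s ≤ T + 1) (a : ℝ≥0) :
    Measurable[observed T M D Z a] (cumClaims M D Z j s a) := by
  refine Measurable.mono (comap_measurable _) ?_ le_rfl
  exact le_iSup₂_of_le j hj (le_iSup₂_of_le s hs (le_iSup_of_le hjs le_rfl))

/-- The claims of accident year `i` that are still to come are independent of the observed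
triangle: within the accident year by Poisson thinning, and across accident years by assumption. -/
lemma SpecialModel.indep_observed (h : SpecialModel P T lam M D Z D₀ Z₀) {i : ℕ}
    (hi : i ∈ Finset.Icc 1 T) (a : ℝ≥0) :
    Indep (MeasurableSpace.comap
      (fun ω => ∑ k ∈ Finset.range (M i a ω), lateMark (T - i + 1) T (D i k ω, Z i k ω))
      inferInstance) (observed T M D Z a) P := by
  set t := T - i + 1 with ht
  have hiT := Finset.mem_Icc.1 hi
  let year (j : Finset.Icc 1 T) (ω : Ω) : ℕ × (ℕ → ℕ × ℝ) :=
    (M j a ω, fun k => (D j k ω, Z j k ω))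
  have hyear (j : Finset.Icc 1 T) : Measurable (year j) := by
    have h1 := (h.poisson j j.2).measurable a
    have h2 := h.measurable_D j j.2
    have h3 := h.measurable_Z j j.2
    fun_prop
  let f (p : ℕ × ℝ) : EuclideanSpace ℝ (Fin (t + 1)) :=
    WithLp.toLp 2 fun s => earlyMark s p
  have hf : Measurable f := by
    have := measurable_earlyMark
    fun_prop
  let X (ω : Ω) : ℝ := ∑ k ∈ Finset.range (M i a ω), lateMark t T (D i k ω, Z i k ω)
  -- `V` collects the observed amounts of year `i`, and `O` all data of the other years
  let V (ω : Ω) : EuclideanSpace ℝ (Fin (t + 1)) :=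
    ∑ k ∈ Finset.range (M i a ω), f (D i k ω, Z i k ω)
  let i' : Finset.Icc 1 T := ⟨i, hi⟩
  let O (ω : Ω) (j : Finset.univ.erase i') : ℕ × (ℕ → ℕ × ℝ) := year j ω
  have hX : Measurable X := (measurable_sum_range (measurable_lateMark t T)).comp (hyear i')
  have hV : Measurable V := (measurable_sum_range hf).comp (hyear i')
  have hO : Measurable O := measurable_pi_lambda _ fun j => hyear j
  have hXV : IndepFun X V P := by
    refine (h.isPoissonSample hi a).indepFun_sum_sum (measurable_lateMark t T) hf fun p => ?_
    by_cases hp : t < p.1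
    · right
      refine WithLp.ofLp_injective 2 (funext fun s => if_neg ?_)
      have := s.2
      omega
    · left
      exact if_neg fun hp' => hp hp'.1
  have hXVO : IndepFun (fun ω => (X ω, V ω)) O P := by
    have hind := (h.indep_years a).indepFun_finset {i'} (Finset.univ.erase i')
      (by simp) hyear
    have hφ : Measurable fun y : ({i'} : Finset (Finset.Icc 1 T)) → ℕ × (ℕ → ℕ × ℝ) =>
        ((∑ k ∈ Finset.range (y ⟨i', by simp⟩).1, lateMark t T ((y ⟨i', by simp⟩).2 k)),
          ∑ k ∈ Finset.range (y ⟨i', by simp⟩).1, f ((y ⟨i', by simp⟩).2 k)) :=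
      ((measurable_sum_range (measurable_lateMark t T)).prodMk (measurable_sum_range hf)).comp
        (measurable_pi_apply _)
    exact hind.comp hφ measurable_id
  have hmain := hXV.prodMk_right_of_prodMk_left hX hV hO hXVO
  rw [IndepFun_iff_Indep] at hmain
  refine indep_of_indep_of_le_right hmain ?_
  refine iSup₂_le fun j hj => iSup₂_le fun s hs => iSup_le fun hjs => ?_
  rw [← measurable_iff_comap_le]
  have hVO := comap_measurable (m := Prod.instMeasurableSpace) fun ω => (V ω, O ω)
  by_cases hji : j = i
  · subst hji
    have hst : s < t + 1 := by omega
    have : Measurable fun p : EuclideanSpace ℝ (Fin (t + 1)) ×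
        ((j : Finset.univ.erase i') → ℕ × (ℕ → ℕ × ℝ)) => p.1 ⟨s, hst⟩ := by fun_prop
    convert this.comp hVO using 1
    ext ω
    simp [V, f, cumClaims_eq_sum_earlyMark]
  · have hmem : (⟨j, hj⟩ : Finset.Icc 1 T) ∈ Finset.univ.erase i' := by simp [i', hji]
    exact (measurable_sum_range (measurable_earlyMark s)).comp
      ((measurable_pi_apply (⟨⟨j, hj⟩, hmem⟩ : Finset.univ.erase i')).comp
        (measurable_snd.comp hVO))

end Observed

/-! ### Moments of the generic claim and the development factors -/

section Claims

variable {Ω : Type*} [MeasurableSpace Ω] {P : Measure Ω} [IsProbabilityMeasure P] {T : ℕ}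
  {lam : ℕ → ℝ≥0} {M : ℕ → ℝ≥0 → Ω → ℕ} {D : ℕ → ℕ → Ω → ℕ} {Z : ℕ → ℕ → Ω → ℝ} {D₀ : Ω → ℕ}
  {Z₀ : Ω → ℝ}

namespace SpecialModel

omit [IsProbabilityMeasure P] in
/-- As `D` and `Z` are independent, restricting to an event of `D` multiplies moments of `Z` by its
probability. -/
lemma integral_ite (h : SpecialModel P T lam M D Z D₀ Z₀) (p : ℕ → Prop) [DecidablePred p]
    {φ : ℝ → ℝ} (hφ : Measurable φ) :
    ∫ ω, (if p (D₀ ω) then φ (Z₀ ω) else 0) ∂P =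
      P.real {ω | p (D₀ ω)} * ∫ ω, φ (Z₀ ω) ∂P := by
  have hind := h.indep_D_Z.integral_fun_comp_mul_comp
    (f := Set.indicator {n | p n} (1 : ℕ → ℝ)) (g := φ)
    h.measurable_D₀.aemeasurable h.measurable_Z₀.aemeasurable
    (measurable_of_countable _).aestronglyMeasurable hφ.aestronglyMeasurable
  have hset : MeasurableSet {ω | p (D₀ ω)} := h.measurable_D₀ (MeasurableSet.of_discrete)
  rw [← integral_indicator_one hset]
  refine Eq.trans (integral_congr_ae (ae_of_all _ fun ω => ?_)) hind
  by_cases hp : p (D₀ ω) <;> simp [hp]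

omit [IsProbabilityMeasure P] in
lemma prob_pos_and_mean_pos (h : SpecialModel P T lam M D Z D₀ Z₀) {t : ℕ}
    (ht : t ∈ Finset.Icc 1 T) : 0 < P.real {ω | D₀ ω = t} ∧ 0 < ∫ ω, Z₀ ω ∂P := by
  have hm := h.mean_pos t ht
  rw [h.integral_ite (fun n => n = t) (φ := fun x => x) measurable_id] at hm
  have hp : 0 < P.real {ω | D₀ ω = t} := measureReal_nonneg.lt_of_ne fun h0 => by simp [← h0] at hm
  exact ⟨hp, (pos_iff_pos_of_mul_pos hm).1 hp⟩

lemma prob_le_pos (h : SpecialModel P T lam M D Z D₀ Z₀) {s : ℕ} (hs : 1 ≤ s) (hT : 1 ≤ T) :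
    0 < P.real {ω | D₀ ω ≤ s} :=
  (h.prob_pos_and_mean_pos (Finset.mem_Icc.2 ⟨le_rfl, hT⟩)).1.trans_le
    (measureReal_mono fun ω (hω : D₀ ω = 1) => show D₀ ω ≤ s by omega)

lemma prob_le_last (h : SpecialModel P T lam M D Z D₀ Z₀) : P.real {ω | D₀ ω ≤ T} = 1 := by
  have hae : {ω | D₀ ω ≤ T} =ᵐ[P] Set.univ := by
    rw [eventuallyEq_univ]
    filter_upwards [h.mem_years] with ω hω using (Finset.mem_Icc.1 hω).2
  rw [measureReal_congr hae, probReal_univ]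

lemma prob_lt (h : SpecialModel P T lam M D Z D₀ Z₀) (s : ℕ) :
    P.real {ω | s < D₀ ω} = 1 - P.real {ω | D₀ ω ≤ s} := by
  have hset : MeasurableSet {ω | D₀ ω ≤ s} := h.measurable_D₀ (measurableSet_Iic (a := s))
  rw [← probReal_compl_eq_one_sub hset]
  congr 1
  ext ω
  exact (not_le (a := D₀ ω) (b := s)).symm

omit [IsProbabilityMeasure P] in
/-- Development years beyond `T` have probability zero. -/
lemma prob_lt_and_le_last (h : SpecialModel P T lam M D Z D₀ Z₀) (s : ℕ) :
    P.real {ω | s < D₀ ω ∧ D₀ ω ≤ T} = P.real {ω | s < D₀ ω} := by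
  refine measureReal_congr ?_
  filter_upwards [h.mem_years] with ω hω
  exact propext (and_iff_left (Finset.mem_Icc.1 hω).2)

omit [IsProbabilityMeasure P] in
lemma devFactor_eq (h : SpecialModel P T lam M D Z D₀ Z₀) (hT : 1 ≤ T) (s : ℕ) :
    devFactor P D₀ Z₀ s = P.real {ω | D₀ ω ≤ s + 1} / P.real {ω | D₀ ω ≤ s} := by
  have hpos := (h.prob_pos_and_mean_pos (Finset.mem_Icc.2 ⟨le_rfl, hT⟩)).2
  rw [devFactor, h.integral_ite (fun n => n ≤ s + 1) (φ := fun x => x) measurable_id,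
    h.integral_ite (fun n => n ≤ s) (φ := fun x => x) measurable_id,
    mul_div_mul_right _ _ hpos.ne']

/-- The two quotients in the definition of `σ²` both reduce to `E[Z²] / E[Z]`. -/
lemma sigmaSq_eq (h : SpecialModel P T lam M D Z D₀ Z₀) {s : ℕ} (hs : 1 ≤ s) (hsT : s < T) :
    sigmaSq P D₀ Z₀ s = (∫ ω, Z₀ ω ^ 2 ∂P) / (∫ ω, Z₀ ω ∂P) *
      (devFactor P D₀ Z₀ s * (devFactor P D₀ Z₀ s - 1)) := by
  obtain ⟨hp, hpos⟩ := h.prob_pos_and_mean_pos (t := s + 1) (Finset.mem_Icc.2 ⟨by omega, hsT⟩)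
  have hq := h.prob_le_pos hs (by omega)
  have hsq : Measurable fun x : ℝ => x ^ 2 := by fun_prop
  rw [sigmaSq, h.integral_ite (fun n => n = s + 1) hsq,
    h.integral_ite (fun n => n = s + 1) (φ := fun x => x) measurable_id,
    h.integral_ite (fun n => n ≤ s) hsq,
    h.integral_ite (fun n => n ≤ s) (φ := fun x => x) measurable_id,
    mul_div_mul_left _ _ hp.ne', mul_div_mul_left _ _ hq.ne']
  ring

end SpecialModel

lemma prod_Ico_succ_div {q : ℕ → ℝ} {t n : ℕ} (htn : t ≤ n) (hq : ∀ s, t ≤ s → q s ≠ 0) :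
    ∏ s ∈ Finset.Ico t n, q (s + 1) / q s = q n / q t := by
  induction n, htn using Nat.le_induction with
  | base => simp [hq t le_rfl]
  | succ n hn ih =>
    rw [Finset.prod_Ico_succ_top hn, ih]
    have := hq n hn
    field_simp

/-- With `f_s = q_{s+1} / q_s`, every term of the sum is a multiple of `1 / q_s - 1 / q_{s+1}`, so
that the sum telescopes. -/
lemma sum_prod_mul_prod_sq {q : ℕ → ℝ} {t T : ℕ} (htT : t ≤ T) (hq : ∀ s, t ≤ s → q s ≠ 0) :
    ∑ n ∈ Finset.Ico t T, (∏ s ∈ Finset.Ico t n, q (s + 1) / q s) *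
        (q (n + 1) / q n * (q (n + 1) / q n - 1)) *
        ∏ s ∈ Finset.Ico (n + 1) T, (q (s + 1) / q s) ^ 2 =
      q T / q t * (q T / q t - 1) := by
  have hterm : ∀ n ∈ Finset.Ico t T, (∏ s ∈ Finset.Ico t n, q (s + 1) / q s) *
        (q (n + 1) / q n * (q (n + 1) / q n - 1)) *
        ∏ s ∈ Finset.Ico (n + 1) T, (q (s + 1) / q s) ^ 2 =
      q T ^ 2 / q t * -((q (n + 1))⁻¹ - (q n)⁻¹) := fun n hn => by
    obtain ⟨h1, h2⟩ := Finset.mem_Ico.1 hn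
    rw [Finset.prod_pow, prod_Ico_succ_div h1 hq,
      prod_Ico_succ_div h2 fun s hs => hq s (by omega)]
    have h3 := hq n h1
    have h4 := hq (n + 1) (by omega)
    have h5 := hq t le_rfl
    field_simp
    ring
  rw [Finset.sum_congr rfl hterm, ← Finset.mul_sum, Finset.sum_neg_distrib,
    Finset.sum_Ico_sub (fun n => (q n)⁻¹) htT]
  have h5 := hq t le_rfl
  have h6 := hq T htT
  field_simp
  ring

end Claims

/-! ### The chi squared distribution -/

section ChiSquared

variable {Ω' : Type*} [MeasurableSpace Ω'] {P' : Measure Ω'} {Q : Ω' → ℝ}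

lemma map_comp_chiSquaredOne (hQ : HasLaw Q chiSquaredOne P') {φ : ℝ → ℝ} (hφ : Measurable φ) :
    (gaussianReal 0 1).map (fun x => φ (x ^ 2)) = P'.map fun ω => φ (Q ω) := by
  have h := AEMeasurable.map_map_of_aemeasurable hφ.aemeasurable hQ.aemeasurable
  rw [hQ.map_eq, chiSquaredOne, Measure.map_map hφ (by fun_prop)] at h
  exact h

lemma integrable_chiSquaredOne (hQ : HasLaw Q chiSquaredOne P') : Integrable Q P' := by
  have h : Integrable (fun x : ℝ => x) chiSquaredOne := by
    refine (integrable_map_measure (g := fun x : ℝ => x) measurable_id.aestronglyMeasurable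
      (by fun_prop)).2 ?_
    exact (memLp_id_gaussianReal 2).integrable_sq
  rw [← hQ.map_eq] at h
  exact (integrable_map_measure measurable_id.aestronglyMeasurable hQ.aemeasurable).1 h

lemma integral_chiSquaredOne (hQ : HasLaw Q chiSquaredOne P') : ∫ ω, Q ω ∂P' = 1 := by
  have h : Var[id; gaussianReal 0 1] = ((1 : ℝ≥0) : ℝ) := variance_id_gaussianReal
  rw [variance_eq_sub (memLp_id_gaussianReal 2)] at h
  rw [hQ.integral_eq, chiSquaredOne, integral_map (by fun_prop) (by fun_prop)]
  simpa using h

end ChiSquared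

/-! ### The standardized squared error -/

section SquaredError

variable {Ω : Type*} [MeasurableSpace Ω] {P : Measure Ω} [IsProbabilityMeasure P] {T : ℕ}
  {lam : ℕ → ℝ≥0} {M : ℕ → ℝ≥0 → Ω → ℕ} {D : ℕ → ℕ → Ω → ℕ} {Z : ℕ → ℕ → Ω → ℝ} {D₀ : Ω → ℕ}
  {Z₀ : Ω → ℝ}

namespace SpecialModel

lemma devProduct_eq (h : SpecialModel P T lam M D Z D₀ Z₀) {i : ℕ} (hi : i ∈ Finset.Icc 1 T) :
    devProduct P T D₀ Z₀ i = (P.real {ω | D₀ ω ≤ T - i + 1})⁻¹ := by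
  have hi' := Finset.mem_Icc.1 hi
  have hT : 1 ≤ T := by omega
  simp only [devProduct, h.devFactor_eq hT]
  rw [prod_Ico_succ_div (q := fun s => P.real {ω | D₀ ω ≤ s}) (by omega)
    fun s hs => (h.prob_le_pos (by omega) hT).ne', h.prob_le_last, one_div]

omit [IsProbabilityMeasure P] in
lemma memLp_earlyMark (h : SpecialModel P T lam M D Z D₀ Z₀) (s : ℕ) :
    MemLp (fun ω => earlyMark s (D₀ ω, Z₀ ω)) 2 P := by
  refine h.sq_integrable.mono ((measurable_earlyMark s).comp
    (h.measurable_D₀.prodMk h.measurable_Z₀)).aestronglyMeasurable (ae_of_all _ fun ω => ?_)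
  unfold earlyMark
  split_ifs <;> simp

omit [IsProbabilityMeasure P] in
lemma memLp_lateMark (h : SpecialModel P T lam M D Z D₀ Z₀) (t : ℕ) :
    MemLp (fun ω => lateMark t T (D₀ ω, Z₀ ω)) 2 P := by
  refine h.sq_integrable.mono ((measurable_lateMark t T).comp
    (h.measurable_D₀.prodMk h.measurable_Z₀)).aestronglyMeasurable (ae_of_all _ fun ω => ?_)
  unfold lateMark
  split_ifs <;> simp

omit [IsProbabilityMeasure P] in
lemma integral_earlyMark (h : SpecialModel P T lam M D Z D₀ Z₀) (s : ℕ) :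
    ∫ ω, earlyMark s (D₀ ω, Z₀ ω) ∂P = P.real {ω | D₀ ω ≤ s} * ∫ ω, Z₀ ω ∂P :=
  h.integral_ite (fun n => n ≤ s) (φ := fun x => x) measurable_id

omit [IsProbabilityMeasure P] in
lemma integral_earlyMark_sq (h : SpecialModel P T lam M D Z D₀ Z₀) (s : ℕ) :
    ∫ ω, earlyMark s (D₀ ω, Z₀ ω) ^ 2 ∂P = P.real {ω | D₀ ω ≤ s} * ∫ ω, Z₀ ω ^ 2 ∂P := by
  rw [← h.integral_ite (fun n => n ≤ s) (φ := fun x => x ^ 2) (by fun_prop)]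
  simp [earlyMark, ite_pow]

omit [IsProbabilityMeasure P] in
lemma integral_lateMark (h : SpecialModel P T lam M D Z D₀ Z₀) (t : ℕ) :
    ∫ ω, lateMark t T (D₀ ω, Z₀ ω) ∂P = P.real {ω | t < D₀ ω} * ∫ ω, Z₀ ω ∂P := by
  rw [← h.prob_lt_and_le_last t]
  exact h.integral_ite (fun n => t < n ∧ n ≤ T) (φ := fun x => x) measurable_id

omit [IsProbabilityMeasure P] in
lemma integral_lateMark_sq (h : SpecialModel P T lam M D Z D₀ Z₀) (t : ℕ) :
    ∫ ω, lateMark t T (D₀ ω, Z₀ ω) ^ 2 ∂P = P.real {ω | t < D₀ ω} * ∫ ω, Z₀ ω ^ 2 ∂P := by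
  rw [← h.prob_lt_and_le_last t,
    ← h.integral_ite (fun n => t < n ∧ n ≤ T) (φ := fun x => x ^ 2) (by fun_prop)]
  simp [lateMark, ite_pow]

lemma integral_cumClaims (h : SpecialModel P T lam M D Z D₀ Z₀) {i : ℕ} (hi : i ∈ Finset.Icc 1 T)
    (s : ℕ) (a : ℝ≥0) :
    ∫ ω, cumClaims M D Z i s a ω ∂P =
      lam i * a * (P.real {ω | D₀ ω ≤ s} * ∫ ω, Z₀ ω ∂P) := by
  have := ((h.isPoissonSample hi a).comp (measurable_earlyMark s)).integral_sum
    (h.memLp_earlyMark s)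
  rw [h.integral_earlyMark, NNReal.coe_mul] at this
  exact this

omit [IsProbabilityMeasure P] in
lemma integral_count (h : SpecialModel P T lam M D Z D₀ Z₀) {i : ℕ} (hi : i ∈ Finset.Icc 1 T)
    (a : ℝ≥0) : ∫ ω, (M i a ω : ℝ) ∂P = lam i * a := by
  have := (h.hasLaw_count hi a).integral_comp (f := fun n : ℕ => (n : ℝ))
    (measurable_of_countable _).aestronglyMeasurable
  rw [integral_natCast_poisson, NNReal.coe_mul] at this
  exact this

/-- The conditional expectation of the standardized squared error.  The outstanding claims
`X = C_{i,T} - C_{i,T-i+1}` are independent of the triangle, and `E X = (g - 1) E C_{i,T-i+1}`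
because `g` is the reciprocal of `P(D ≤ T-i+1)`. -/
lemma isCondExp_standardizedSqError (h : SpecialModel P T lam M D Z D₀ Z₀) {i : ℕ}
    (hi : i ∈ Finset.Icc 1 T) {a : ℝ≥0} (ha : 0 < a) :
    IsCondExp (observed T M D Z a) P (standardizedSqError P T M D Z D₀ Z₀ i a)
      (fun ω => (a : ℝ) / cumClaims M D Z i (T - i + 1) a ω *
        ((∫ ω', (M i a ω' : ℝ) ∂P) / a * (∫ ω', Z₀ ω' ^ 2 ∂P) * P.real {ω' | T - i + 1 < D₀ ω'}
          + HSq P T M D Z i a ω * (devProduct P T D₀ Z₀ i - 1) ^ 2)) := by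
  have hi' := Finset.mem_Icc.1 hi
  have ha' : (a : ℝ) ≠ 0 := by exact_mod_cast ha.ne'
  have hsample := (h.isPoissonSample hi a).comp (measurable_lateMark (T - i + 1) T)
  have hmain := isCondExp_sq_sub_div (h.observed_le a) hsample.measurable_sum
    (hsample.memLp_sum (h.memLp_lateMark _)) (h.indep_observed hi a)
    (measurable_cumClaims_observed (s := T - i + 1) hi (Finset.mem_Icc.2 ⟨by omega, by omega⟩)
      (by omega) a)
    (devProduct P T D₀ Z₀ i - 1)
  rw [hsample.variance_sum (h.memLp_lateMark _), hsample.integral_sum (h.memLp_lateMark _),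
    h.integral_lateMark, h.integral_lateMark_sq] at hmain
  convert hmain using 1
  · ext ω
    rw [standardizedSqError, cumClaims_eq_add_lateMark (t := T - i + 1) (T := T) (by omega)]
    ring
  · ext ω
    have hq : P.real {ω | D₀ ω ≤ T - i + 1} ≠ 0 := (h.prob_le_pos (by omega) (by omega)).ne'
    rw [HSq, h.integral_cumClaims hi, h.integral_count hi, h.devProduct_eq hi, h.prob_lt]
    push_cast
    field_simp
    ring

lemma HSq_eq (h : SpecialModel P T lam M D Z D₀ Z₀) {i : ℕ} (hi : i ∈ Finset.Icc 1 T) (a : ℝ≥0)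
    (ω : Ω) :
    HSq P T M D Z i a ω = ((√a)⁻¹ * (cumClaims M D Z i (T - i + 1) a ω -
      lam i * a * ∫ ω, earlyMark (T - i + 1) (D₀ ω, Z₀ ω) ∂P)) ^ 2 := by
  rw [HSq, h.integral_cumClaims hi, h.integral_earlyMark, mul_pow, inv_pow,
    Real.sq_sqrt (NNReal.coe_nonneg a), inv_mul_eq_div]

lemma tendstoInDistribution_HSq_gaussian (h : SpecialModel P T lam M D Z D₀ Z₀) {i : ℕ}
    (hi : i ∈ Finset.Icc 1 T) :
    TendstoInDistribution (HSq P T M D Z i) atTop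
      (fun x : ℝ => lam i * (∫ ω, Z₀ ω ^ 2 ∂P) * P.real {ω | D₀ ω ≤ T - i + 1} * x ^ 2)
      (fun _ => P) (gaussianReal 0 1) := by
  have hclt := tendstoInDistribution_poissonSum
    (fun a => (h.isPoissonSample hi a).comp (measurable_earlyMark (T - i + 1)))
    (h.memLp_earlyMark (T - i + 1))
  have hsq := hclt.continuous_comp (g := fun x : ℝ => x ^ 2) (by fun_prop)
  convert hsq using 1
  · ext a ω
    exact h.HSq_eq hi a ω
  · ext x
    have hnn : (0 : ℝ) ≤ lam i * (P.real {ω | D₀ ω ≤ T - i + 1} * ∫ ω, Z₀ ω ^ 2 ∂P) := by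
      have : 0 ≤ ∫ ω, Z₀ ω ^ 2 ∂P := integral_nonneg fun ω => sq_nonneg _
      positivity
    rw [Function.comp_apply, mul_pow, h.integral_earlyMark_sq, Real.sq_sqrt hnn]
    ring

/-- The limit law of the conditional expectation, by Slutsky's theorem: `(H^a)²` converges in
distribution, while `a / C^a_{i,T-i+1}` converges in probability to a constant. -/
lemma tendstoInDistribution_condExp_gaussian (h : SpecialModel P T lam M D Z D₀ Z₀) {i : ℕ}
    (hi : i ∈ Finset.Icc 1 T) :
    TendstoInDistribution (fun (a : ℝ≥0) ω => (cumClaims M D Z i (T - i + 1) a ω / a)⁻¹ *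
        (lam i * (∫ ω', Z₀ ω' ^ 2 ∂P) * P.real {ω' | T - i + 1 < D₀ ω'}
          + HSq P T M D Z i a ω * (devProduct P T D₀ Z₀ i - 1) ^ 2)) atTop
      (fun x : ℝ => (∫ ω, Z₀ ω ^ 2 ∂P) / (∫ ω, Z₀ ω ∂P) *
          ((devProduct P T D₀ Z₀ i - 1) + (devProduct P T D₀ Z₀ i - 1) ^ 2 * x ^ 2))
      (fun _ => P) (gaussianReal 0 1) := by
  have hi' := Finset.mem_Icc.1 hi
  have hq : P.real {ω | D₀ ω ≤ T - i + 1} ≠ 0 := (h.prob_le_pos (by omega) (by omega)).ne'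
  have hz : ∫ ω, Z₀ ω ∂P ≠ 0 := (h.prob_pos_and_mean_pos hi).2.ne'
  have hl : (lam i : ℝ) ≠ 0 := by exact_mod_cast (h.lam_pos i hi).ne'
  have hlln := tendstoInMeasure_poissonSum_div
    (fun a => (h.isPoissonSample hi a).comp (measurable_earlyMark (T - i + 1)))
    (h.memLp_earlyMark (T - i + 1))
  rw [h.integral_earlyMark] at hlln
  have hinv := tendstoInMeasure_comp_const hlln (f := fun y => y⁻¹)
    (continuousAt_inv₀ (mul_ne_zero hl (mul_ne_zero hq hz)))
  have hslutsky := (h.tendstoInDistribution_HSq_gaussian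
    hi).continuous_comp_prodMk_of_tendstoInMeasure_const
    (g := fun p : ℝ × ℝ => p.2 * (lam i * (∫ ω', Z₀ ω' ^ 2 ∂P) * P.real {ω' | T - i + 1 < D₀ ω'}
          + p.1 * (devProduct P T D₀ Z₀ i - 1) ^ 2)) (by fun_prop) hinv
    (fun a => ((h.measurable_cumClaims hi (T - i + 1) a).div_const _).inv.aemeasurable)
  convert hslutsky using 1
  · rfl
  · ext x
    rw [h.prob_lt, h.devProduct_eq hi]
    field_simp

end SpecialModel

end SquaredError

end ChainLadder

/-! ### The conditional expectation, its limit law and its mean -/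

open ChainLadder in
theorem mainTheorem3 {Ω : Type*} [MeasurableSpace Ω] (P : Measure Ω) [IsProbabilityMeasure P]
    {T : ℕ} {lam : ℕ → ℝ≥0} {M : ℕ → ℝ≥0 → Ω → ℕ} {D : ℕ → ℕ → Ω → ℕ} {Z : ℕ → ℕ → Ω → ℝ}
    {D₀ : Ω → ℕ} {Z₀ : Ω → ℝ} (hmodel : SpecialModel P T lam M D Z D₀ Z₀)
    {i : ℕ} (hi : 2 ≤ i) (hiT : i ≤ T)
    {Ω' : Type*} [MeasurableSpace Ω'] (P' : Measure Ω') [IsProbabilityMeasure P']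
    {Q : Ω' → ℝ} (hQ : HasLaw Q chiSquaredOne P') :
    -- the explicit expression for the conditional expectation
    (∀ a : ℝ≥0, 0 < a →
      IsCondExp (observed T M D Z a) P (standardizedSqError P T M D Z D₀ Z₀ i a)
        (fun ω => (a : ℝ) / cumClaims M D Z i (T - i + 1) a ω *
          ((∫ ω', (M i a ω' : ℝ) ∂P) / a * (∫ ω', Z₀ ω' ^ 2 ∂P) *
              P.real {ω' | T - i + 1 < D₀ ω'}
            + HSq P T M D Z i a ω * (devProduct P T D₀ Z₀ i - 1) ^ 2))) ∧
    -- convergence in distribution of the conditional expectation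
    (∀ L : ℝ≥0 → Ω → ℝ,
      (∀ a, IsCondExp (observed T M D Z a) P (standardizedSqError P T M D Z D₀ Z₀ i a) (L a)) →
      TendstoInDistribution L atTop
        (fun ω' => (∫ ω, Z₀ ω ^ 2 ∂P) / (∫ ω, Z₀ ω ∂P) *
          ((devProduct P T D₀ Z₀ i - 1) + (devProduct P T D₀ Z₀ i - 1) ^ 2 * Q ω'))
        (fun _ => P) P') ∧
    -- convergence in distribution of `(H^a)²`
    TendstoInDistribution (HSq P T M D Z i) atTop
      (fun ω' => (lam i : ℝ) * (∫ ω, Z₀ ω ^ 2 ∂P) * P.real {ω | D₀ ω ≤ T - i + 1} * Q ω')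
      (fun _ => P) P' ∧
    -- the expectation of the limit
    Integrable (fun ω' => (∫ ω, Z₀ ω ^ 2 ∂P) / (∫ ω, Z₀ ω ∂P) *
      ((devProduct P T D₀ Z₀ i - 1) + (devProduct P T D₀ Z₀ i - 1) ^ 2 * Q ω')) P' ∧
    Integrable (fun ω' => (lam i : ℝ) * (∫ ω, Z₀ ω ^ 2 ∂P) *
      P.real {ω | D₀ ω ≤ T - i + 1} * Q ω') P' ∧
    (∫ ω', (∫ ω, Z₀ ω ^ 2 ∂P) / (∫ ω, Z₀ ω ∂P) *
        ((devProduct P T D₀ Z₀ i - 1) + (devProduct P T D₀ Z₀ i - 1) ^ 2 * Q ω') ∂P')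
      = ((lam i : ℝ) * (∫ ω, Z₀ ω ^ 2 ∂P) * P.real {ω | T - i + 1 < D₀ ω}
          + (∫ ω', (lam i : ℝ) * (∫ ω, Z₀ ω ^ 2 ∂P) * P.real {ω | D₀ ω ≤ T - i + 1} * Q ω' ∂P')
            * (devProduct P T D₀ Z₀ i - 1) ^ 2)
        / ((lam i : ℝ) * (∫ ω, Z₀ ω ∂P) * P.real {ω | D₀ ω ≤ T - i + 1}) ∧
    ((lam i : ℝ) * (∫ ω, Z₀ ω ^ 2 ∂P) * P.real {ω | T - i + 1 < D₀ ω}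
          + (∫ ω', (lam i : ℝ) * (∫ ω, Z₀ ω ^ 2 ∂P) * P.real {ω | D₀ ω ≤ T - i + 1} * Q ω' ∂P')
            * (devProduct P T D₀ Z₀ i - 1) ^ 2)
        / ((lam i : ℝ) * (∫ ω, Z₀ ω ∂P) * P.real {ω | D₀ ω ≤ T - i + 1})
      = ∑ t ∈ Finset.Ico (T - i + 1) T,
          (∏ s ∈ Finset.Ico (T - i + 1) t, devFactor P D₀ Z₀ s) * sigmaSq P D₀ Z₀ t *
            ∏ s ∈ Finset.Ico (t + 1) T, devFactor P D₀ Z₀ s ^ 2 := by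
  have hi' : i ∈ Finset.Icc 1 T := Finset.mem_Icc.2 ⟨by omega, hiT⟩
  have hq : P.real {ω | D₀ ω ≤ T - i + 1} ≠ 0 := (hmodel.prob_le_pos (by omega) (by omega)).ne'
  have hz : ∫ ω, Z₀ ω ∂P ≠ 0 := (hmodel.prob_pos_and_mean_pos hi').2.ne'
  have hl : (lam i : ℝ) ≠ 0 := by exact_mod_cast (hmodel.lam_pos i hi').ne'
  have hQint := integrable_chiSquaredOne hQ
  have hQone := integral_chiSquaredOne hQ
  have hQm := hQ.aemeasurable
  refine ⟨fun a ha => hmodel.isCondExp_standardizedSqError hi' ha, fun L hL => ?_, ?_, ?_, ?_, ?_,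
    ?_⟩
  · refine tendstoInDistribution_congr (hmodel.tendstoInDistribution_condExp_gaussian hi')
      (fun a => ((hL a).measurable.mono (hmodel.observed_le a) le_rfl).aemeasurable) ?_
      (by fun_prop) (map_comp_chiSquaredOne hQ (φ := fun y => (∫ ω, Z₀ ω ^ 2 ∂P) / (∫ ω, Z₀ ω ∂P) *
          ((devProduct P T D₀ Z₀ i - 1) + (devProduct P T D₀ Z₀ i - 1) ^ 2 * y)) (by fun_prop))
    -- versions of the conditional expectation are almost surely unique, and the exposure `0`,
    -- where the explicit expression is not available, does not matter for the limit
    filter_upwards [eventually_gt_atTop 0] with a ha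
    have ha' : (a : ℝ) ≠ 0 := by exact_mod_cast ha.ne'
    refine EventuallyEq.trans (.of_eq (funext fun ω => ?_)) ((hmodel.isCondExp_standardizedSqError
      hi' ha).ae_eq (hmodel.observed_le a) (hL a))
    rw [hmodel.integral_count hi', mul_div_cancel_right₀ _ ha', inv_div]
  · exact tendstoInDistribution_congr (hmodel.tendstoInDistribution_HSq_gaussian hi')
      (hmodel.tendstoInDistribution_HSq_gaussian hi').forall_aemeasurable
      (.of_forall fun _ => .rfl) (by fun_prop) (map_comp_chiSquaredOne hQ
        (φ := fun y => lam i * (∫ ω, Z₀ ω ^ 2 ∂P) * P.real {ω | D₀ ω ≤ T - i + 1} * y)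
        (by fun_prop))
  · exact ((integrable_const _).add (hQint.const_mul _)).const_mul _
  · exact hQint.const_mul _
  · rw [integral_const_mul, integral_const_mul, integral_add (integrable_const _)
      (hQint.const_mul _), integral_const_mul, hQone, integral_const, probReal_univ,
      hmodel.prob_lt, hmodel.devProduct_eq hi', one_smul]
    field_simp
  · have hT : 1 ≤ T := by omega
    -- all summands are multiples of `E[Z²] / E[Z]`, because `D` and `Z` are independent
    have hsum := sum_prod_mul_prod_sq (q := fun s => P.real {ω | D₀ ω ≤ s})
      (t := T - i + 1) (T := T) (by omega) fun s hs => (hmodel.prob_le_pos (by omega) hT).ne'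
    rw [hmodel.prob_le_last] at hsum
    have hterm : ∀ t ∈ Finset.Ico (T - i + 1) T,
        (∏ s ∈ Finset.Ico (T - i + 1) t, devFactor P D₀ Z₀ s) * sigmaSq P D₀ Z₀ t *
            ∏ s ∈ Finset.Ico (t + 1) T, devFactor P D₀ Z₀ s ^ 2 =
          (∫ ω, Z₀ ω ^ 2 ∂P) / (∫ ω, Z₀ ω ∂P) *
            ((∏ s ∈ Finset.Ico (T - i + 1) t, devFactor P D₀ Z₀ s) *
              (devFactor P D₀ Z₀ t * (devFactor P D₀ Z₀ t - 1)) *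
              ∏ s ∈ Finset.Ico (t + 1) T, devFactor P D₀ Z₀ s ^ 2) := fun t ht => by
      obtain ⟨h1, h2⟩ := Finset.mem_Ico.1 ht
      rw [hmodel.sigmaSq_eq (by omega) h2]
      ring
    rw [Finset.sum_congr rfl hterm, ← Finset.mul_sum]
    simp only [hmodel.devFactor_eq hT]
    rw [hsum, integral_const_mul, hQone, hmodel.prob_lt, hmodel.devProduct_eq hi']
    field_simp
    ring
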